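/- Let $N, k \ge 0$ be integers, $\alpha \in (0,1]$, and let $\Omega, U \subseteq \mathbb{R}^N$ be open and bounded with $\Omega \Subset U$ (that is, $\overline{\Omega}$ is compact and $\overline{\Omega} \subseteq U$). For a symmetric $\ell$-linear form $\Lambda$ on $\mathbb{R}^N$ write $\|\Lambda\| = \sup_{|v|\le 1} |\Lambda[v,\dots,v]|$ (the absolute value of the number $\Lambda$ if $\ell = 0$). Let $a : U \to [0,\infty)$ be of class $C^{k,\alpha}(U)$, i.e. $a$ is $k$ times continuously differentiable on $U$ and there is $C$ with $\|D^k a(x) - D^k a(y)\| \le C|x-y|^{\alpha}$ for all $x,y \in U$. Then there exist functions $\sigma, \omega : \Omega \to [0,\infty)$ with $a = \sigma\omega$ on $\Omega$ such that: 1. $\sigma(x) = \sum_{i=0}^{k} \|D^i a(x)\|^{\frac{k+\alpha}{k+\alpha-i}}$ for all $x \in \Omega$, and $\sigma$ belongs to the decay class $\mathcal{Z}^{k+\alpha}(\Omega)$: there is a constant $C$ with $\sigma(x) \le C\left(\sigma(y) + |x-y|^{k+\alpha}\right)$ for all $x, y \in \Omega$; 2. $\omega \in L^\infty(\Omega)$,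 and $\omega$ belongs to the local Muckenhoupt class $A_{r}(\Omega)$ with $r = k+\alpha+1$: $\omega$ is measurable, $\omega > 0$ almost everywhere in $\Omega$, and $$\sup_{B \subseteq \Omega} \left( \frac{1}{|B|}\int_{B} \omega \, dz \right)\left( \frac{1}{|B|}\int_{B} \omega^{-\frac{1}{r-1}} \, dz\right)^{r-1} < \infty,$$ where the supremum is over all balls $B$ contained in $\Omega$. -/

import Mathlib

open MeasureTheory

noncomputable section

/-- The operator norm `sup_{|v| ≤ 1} |Λ[v, …, v]|` of an `ℓ`-linear form on `ℝ^N` (used for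
symmetric forms). For `ℓ = 0` it is the absolute value of the number `Λ`. -/
def diagNorm {N ℓ : ℕ}
    (Λ : ContinuousMultilinearMap ℝ (fun _ : Fin ℓ => EuclideanSpace ℝ (Fin N)) ℝ) : ℝ :=
  ⨆ v : Metric.closedBall (0 : EuclideanSpace ℝ (Fin N)) 1,
    |Λ (fun _ => (v : EuclideanSpace ℝ (Fin N)))|

/-- The supremum in `diagNorm` is a genuine one: the family is bounded above. -/
theorem diagNorm_bddAbove {N ℓ : ℕ}
    (Λ : ContinuousMultilinearMap ℝ (fun _ : Fin ℓ => EuclideanSpace ℝ (Fin N)) ℝ) :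
    BddAbove (Set.range fun v : Metric.closedBall (0 : EuclideanSpace ℝ (Fin N)) 1 =>
      |Λ (fun _ => (v : EuclideanSpace ℝ (Fin N)))|) := by
  refine ⟨‖Λ‖, ?_⟩
  rintro _ ⟨v, rfl⟩
  have hv : ‖(v : EuclideanSpace ℝ (Fin N))‖ ≤ 1 :=
    mem_closedBall_zero_iff.1 v.2
  have h := Λ.le_opNorm (fun _ => (v : EuclideanSpace ℝ (Fin N)))
  rw [Real.norm_eq_abs] at h
  refine h.trans (mul_le_of_le_one_right (norm_nonneg _) ?_)
  exact Finset.prod_le_one (fun _ _ => norm_nonneg _) (fun _ _ => hv)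

/-- `Ω ⋐ U`: the closure of `Ω` is compact and contained in `U`. -/
def CompactlyContained {N : ℕ} (Ω U : Set (EuclideanSpace ℝ (Fin N))) : Prop :=
  IsCompact (closure Ω) ∧ closure Ω ⊆ U

/-- `a ∈ C^{k,α}(U)` for an open set `U`: `a` is `k` times continuously differentiable on `U` and
`D^k a` is `α`-Hölder continuous on `U` (one constant for all pairs of points of `U`). Only the
values of `a` on `U` matter, since `U` is open. -/
def HolderClass {N : ℕ} (k : ℕ) (α : ℝ) (U : Set (EuclideanSpace ℝ (Fin N)))
    (a : EuclideanSpace ℝ (Fin N) → ℝ) : Prop :=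
  ContDiffOn ℝ (k : WithTop ℕ∞) a U ∧
    ∃ C : ℝ, ∀ x ∈ U, ∀ y ∈ U,
      diagNorm (iteratedFDeriv ℝ k a x - iteratedFDeriv ℝ k a y) ≤ C * ‖x - y‖ ^ α

/-- The decay class `Z^κ(U)`: nonnegative functions with `σ(x) ≤ C (σ(y) + |x - y|^κ)` on `U`. -/
def DecayClass {N : ℕ} (κ : ℝ) (U : Set (EuclideanSpace ℝ (Fin N)))
    (σ : EuclideanSpace ℝ (Fin N) → ℝ) : Prop :=
  (∀ x ∈ U, 0 ≤ σ x) ∧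
    ∃ C : ℝ, ∀ x ∈ U, ∀ y ∈ U, σ x ≤ C * (σ y + ‖x - y‖ ^ κ)

/-- The local Muckenhoupt class `A_r(U)`, `1 < r < ∞`. The integrals are taken in `[0, ∞]`, with
`0 ^ (-1/(r-1)) = ∞`. The weight is required to be positive almost everywhere, so that a product
`0 * ∞` never occurs in the supremum; its finiteness then says in particular that both averages
are finite on every ball in `U`. -/
structure MuckenhouptClass {N : ℕ} (r : ℝ) (U : Set (EuclideanSpace ℝ (Fin N)))
    (ω : EuclideanSpace ℝ (Fin N) → ℝ) : Prop where
  nonneg : ∀ x ∈ U, 0 ≤ ω x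
  aemeasurable : AEMeasurable ω (volume.restrict U)
  ae_pos : ∀ᵐ x ∂(volume.restrict U), 0 < ω x
  iSup_lt_top :
    (⨆ (x : EuclideanSpace ℝ (Fin N)) (ρ : ℝ) (_ : 0 < ρ) (_ : Metric.ball x ρ ⊆ U),
      (⨍⁻ z in Metric.ball x ρ, ENNReal.ofReal (ω z) ∂volume) *
        (⨍⁻ z in Metric.ball x ρ, ENNReal.ofReal (ω z) ^ (-(1 / (r - 1))) ∂volume) ^ (r - 1)) < ⊤

end

/-! Write κ = k + α, so that r - 1 = κ. Take ω = a/σ where σ ≠ 0 and ω = 1 where σ = 0. The summand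
i = 0 of σ is |a|, hence a ≤ σ and 0 ≤ ω ≤ 1, and a vanishes wherever σ does. The natural length
scale is s = σ^(1/κ): the derivatives satisfy ‖D^i a(x)‖ ≤ s(x)^(κ-i), which is homogeneous of
degree κ together with the Hölder remainder H ρ^κ. Propagating these bounds from the centre of a
ball gives the decay of σ (`exists_derivGauge_le`, `exists_derivGauge_decay`).

For the Muckenhoupt bound on a ball of radius ρ about x, put m = ∑ ‖D^j a(x)‖ ρ^j. If ρ ≤ c s(x),
the remainder H ρ^κ is small compared with m, and then some pure directional derivative of order i ≤
k stays of size at least a multiple of m ρ^(-i) on the whole ball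
(`exists_directional_lower_bound`). A van der Corput sublevel estimate on lines and Fubini give |{a
≤ l}| ≲ (l/m)^β |B| with some β > 1/κ, which is possible because only orders up to k < κ occur.
Hence the average of a^(-1/κ) is ≲ m^(-1/κ) (`exists_lintegral_rpow_neg_le`). On such a ball
contained in Ω, σ is comparable with σ(x), so the average of ω is ≲ m/σ(x), the κ-th power of the
average of ω^(-1/κ) is ≲ σ(x)/m, and m cancels.

If ρ > c s(x), the bound ω ≤ 1 handles the first average. For the second, the ball is covered by
balls of radius c s(y), y in the ball; on each of them m is at least a multiple of σ(y), so the
average of ω^(-1/κ) is bounded. By decay these radii are ≲ ρ, and a Vitali selection sums the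
estimates (`setLIntegral_ball_le_of_local_bounds`). Points with s(y) = 0 are harmless since ω = 1
there. -/

/-! ### Sublevel sets of functions of one variable -/

/-- A function with derivative at least `c` on an interval grows at least with slope `c`. -/
theorem mul_sub_le_sub_of_le_hasDerivAt {g g' : ℝ → ℝ} {J : Set ℝ} {c : ℝ}
    (hJ : J.OrdConnected) (hg : ∀ t ∈ J, HasDerivAt g (g' t) t) (hc : ∀ t ∈ J, c ≤ g' t)
    {s t : ℝ} (hs : s ∈ J) (ht : t ∈ J) (hst : s ≤ t) : c * (t - s) ≤ g t - g s :=
  Convex.mul_sub_le_image_sub_of_le_deriv hJ.convex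
    (fun u hu => (hg u hu).continuousAt.continuousWithinAt)
    (fun u hu => (hg u (interior_subset hu)).differentiableAt.differentiableWithinAt)
    (fun u hu => (hg u (interior_subset hu)).deriv ▸ hc u (interior_subset hu)) s hs t ht hst

theorem volume_abs_le_of_le_hasDerivAt {g g' : ℝ → ℝ} {J : Set ℝ} {c δ : ℝ} (hc0 : 0 < c)
    (hJ : J.OrdConnected) (hg : ∀ t ∈ J, HasDerivAt g (g' t) t) (hc : ∀ t ∈ J, c ≤ g' t) :
    volume {t | t ∈ J ∧ |g t| ≤ δ} ≤ ENNReal.ofReal (2 * (δ / c)) := by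
  refine (Real.volume_le_diam _).trans ?_
  refine Metric.ediam_le ?_
  have key : ∀ s t : ℝ, s ∈ J → t ∈ J → |g s| ≤ δ → |g t| ≤ δ → s ≤ t → t - s ≤ 2 * (δ / c) := by
    intro s t hs ht h1 h2 hst
    have h := mul_sub_le_sub_of_le_hasDerivAt hJ hg hc hs ht hst
    rw [abs_le] at h1 h2
    rw [mul_div_assoc', le_div_iff₀ hc0]
    linarith
  rintro s ⟨hs, h1⟩ t ⟨ht, h2⟩
  rw [edist_dist, Real.dist_eq]
  refine ENNReal.ofReal_le_ofReal ?_
  rcases le_total s t with h | h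
  · rw [abs_sub_comm, abs_of_nonneg (sub_nonneg.2 h)]; exact key s t hs ht h1 h2 h
  · rw [abs_of_nonneg (sub_nonneg.2 h)]; exact key t s ht hs h2 h1 h

/-- Sublevel set estimate of van der Corput type: `f 0, f 1, …` are successive derivatives. -/
theorem volume_sublevel_le (n : ℕ) : ∀ (f : ℕ → ℝ → ℝ) (J : Set ℝ) (c l : ℝ),
    J.OrdConnected → 0 < c → 0 < l →
    (∀ j ≤ n, ∀ t ∈ J, HasDerivAt (f j) (f (j + 1) t) t) → (∀ t ∈ J, c ≤ f (n + 1) t) →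
    volume {t | t ∈ J ∧ |f 0 t| ≤ l} ≤
      ENNReal.ofReal ((2 ^ (n + 2) - 2) * (l / c) ^ (1 / ((n : ℝ) + 1))) := by
  induction n with
  | zero =>
    intro f J c l hJ hc hl hf hfc
    refine (volume_abs_le_of_le_hasDerivAt hc hJ (hf 0 le_rfl) hfc).trans_eq ?_
    norm_num
  | succ n ih =>
    intro f J c l hJ hc hl hf hfc
    -- The threshold δ = c y balances the two contributions: where `|f (n + 1)|` exceeds δ,
    -- induction gives the factor (l/δ)^(1/(n+1)) = y, and the rest has length at most 2δ/c = 2y.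
    -- The constants obey C' = 2C + 2, whence 2^(n+2) - 2.
    set y : ℝ := (l / c) ^ (1 / ((n + 1 : ℕ) + 1 : ℝ)) with hy
    have hlc : 0 < l / c := by positivity
    have hy0 : 0 < y := Real.rpow_pos_of_pos hlc _
    set δ := c * y with hδ
    have hδ0 : 0 < δ := by positivity
    -- Monotonicity makes the regions `δ ≤ f (n + 1)` and `f (n + 1) ≤ -δ` order-connected, as the
    -- induction hypothesis requires.
    have hmono : ∀ s ∈ J, ∀ t ∈ J, s ≤ t → f (n + 1) s ≤ f (n + 1) t := by
      intro s hs t ht hst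
      have h := mul_sub_le_sub_of_le_hasDerivAt hJ (hf (n + 1) le_rfl) hfc hs ht hst
      nlinarith [mul_nonneg hc.le (sub_nonneg.2 hst)]
    have hexp : (l / δ) ^ (1 / ((n : ℝ) + 1)) = y := by
      have hn : (n : ℝ) + 1 ≠ 0 := by positivity
      have hn2 : (n : ℝ) + 2 ≠ 0 := by positivity
      have h1 : l / δ = (l / c) ^ (1 - 1 / ((n + 1 : ℕ) + 1 : ℝ)) := by
        rw [Real.rpow_sub hlc, Real.rpow_one, hδ, hy, div_div]
      rw [h1, ← Real.rpow_mul hlc.le, hy]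
      congr 1
      push_cast
      have : (n : ℝ) + 1 + 1 ≠ 0 := by positivity
      field_simp
      ring
    have h1 := ih f {t | t ∈ J ∧ δ ≤ f (n + 1) t} δ l
      ⟨fun s hs t ht u hu => ⟨hJ.out hs.1 ht.1 hu,
        hs.2.trans (hmono s hs.1 u (hJ.out hs.1 ht.1 hu) hu.1)⟩⟩ hδ0 hl
      (fun j hj t ht => hf j (hj.trans n.le_succ) t ht.1) (fun t ht => ht.2)
    have h2 := ih (fun j t => - f j t) {t | t ∈ J ∧ f (n + 1) t ≤ -δ} δ l
      ⟨fun s hs t ht u hu => ⟨hJ.out hs.1 ht.1 hu,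
        (hmono u (hJ.out hs.1 ht.1 hu) t ht.1 hu.2).trans ht.2⟩⟩ hδ0 hl
      (fun j hj t ht => (hf j (hj.trans n.le_succ) t ht.1).neg) (fun t ht => by linarith [ht.2])
    have h3 := volume_abs_le_of_le_hasDerivAt (δ := δ) hc hJ (hf (n + 1) le_rfl) hfc
    rw [hexp] at h1 h2
    have hsub : {t | t ∈ J ∧ |f 0 t| ≤ l} ⊆
        ({t | t ∈ {t | t ∈ J ∧ δ ≤ f (n + 1) t} ∧ |f 0 t| ≤ l} ∪
          {t | t ∈ {t | t ∈ J ∧ f (n + 1) t ≤ -δ} ∧ |-f 0 t| ≤ l}) ∪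
          {t | t ∈ J ∧ |f (n + 1) t| ≤ δ} := by
      rintro t ⟨ht, hl⟩
      by_cases h1 : δ ≤ f (n + 1) t
      · exact Or.inl (Or.inl ⟨⟨ht, h1⟩, hl⟩)
      by_cases h2 : f (n + 1) t ≤ -δ
      · exact Or.inl (Or.inr ⟨⟨ht, h2⟩, by rwa [abs_neg]⟩)
      · exact Or.inr ⟨ht, abs_le.2 ⟨by linarith, by linarith⟩⟩
    refine (measure_mono hsub).trans ((measure_union_le _ _).trans
      ((add_le_add ((measure_union_le _ _).trans (add_le_add h1 h2)) h3).trans_eq ?_))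
    have h2n : (0 : ℝ) ≤ 2 ^ (n + 2) - 2 := by
      have : (1 : ℝ) ≤ 2 ^ (n + 1) := one_le_pow₀ (by norm_num)
      rw [pow_succ]; linarith
    rw [← ENNReal.ofReal_add (by positivity) (by positivity),
      ← ENNReal.ofReal_add (by positivity) (by positivity)]
    congr 1
    rw [hδ, mul_div_cancel_left₀ _ hc.ne', pow_succ 2 (n + 2)]
    ring

/-- The sublevel estimate on an interval of length at most `L`, in a scale-invariant form and with
one exponent `β` for all orders `n` with `β n ≤ 1`. -/
theorem volume_sublevel_le_rpow (n : ℕ) {β : ℝ} (hβ : 0 < β) (hβn : β * n ≤ 1)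
    (f : ℕ → ℝ → ℝ) (J : Set ℝ) {c l L : ℝ} (hJ : J.OrdConnected) (hc : 0 < c) (hl : 0 < l)
    (hL : 0 < L) (hJL : volume J ≤ ENNReal.ofReal L)
    (hf : ∀ j < n, ∀ t ∈ J, HasDerivAt (f j) (f (j + 1) t) t) (hfc : ∀ t ∈ J, c ≤ f n t) :
    volume {t | t ∈ J ∧ |f 0 t| ≤ l} ≤
      ENNReal.ofReal (2 ^ (n + 1) * L * (l / (c * L ^ n)) ^ β) := by
  have hx : 0 < l / (c * L ^ n) := by positivity
  -- For a ratio at least 1 the trivial bound L suffices; below 1, replacing the exponent 1/n by the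
  -- smaller β only enlarges the power.
  by_cases h1 : 1 ≤ l / (c * L ^ n)
  · refine (measure_mono fun t ht => ht.1).trans (hJL.trans (ENNReal.ofReal_le_ofReal ?_))
    have h2 : 1 ≤ (l / (c * L ^ n)) ^ β := Real.one_le_rpow h1 hβ.le
    have h3 : (1 : ℝ) ≤ 2 ^ (n + 1) := one_le_pow₀ (by norm_num)
    calc L = 1 * L * 1 := by ring
      _ ≤ _ := by gcongr
  push Not at h1
  rcases n with _ | n
  · have : {t | t ∈ J ∧ |f 0 t| ≤ l} = ∅ := by
      refine Set.eq_empty_of_forall_notMem fun t ht => ?_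
      rw [pow_zero, mul_one, div_lt_one hc] at h1
      have := (hfc t ht.1).trans ((le_abs_self _).trans ht.2)
      linarith
    simp [this]
  · refine (volume_sublevel_le n f J c l hJ hc hl (fun j hj => hf j (by omega)) hfc).trans
      (ENNReal.ofReal_le_ofReal ?_)
    have e : l / c = (l / (c * L ^ (n + 1))) * L ^ (n + 1) := by
      field_simp
    have e2 : (L ^ (n + 1)) ^ (1 / ((n : ℝ) + 1)) = L := by
      rw [one_div]; exact_mod_cast Real.pow_rpow_inv_natCast hL.le n.succ_ne_zero
    rw [e, Real.mul_rpow hx.le (by positivity), e2, mul_comm _ L, ← mul_assoc]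
    have : (l / (c * L ^ (n + 1))) ^ (1 / ((n : ℝ) + 1)) ≤ (l / (c * L ^ (n + 1))) ^ β := by
      refine Real.rpow_le_rpow_of_exponent_ge hx h1.le ?_
      rw [le_div_iff₀ (by positivity)]; exact_mod_cast hβn
    have h2 : (2 : ℝ) ^ (n + 2) - 2 ≤ 2 ^ (n + 1 + 1) := by linarith
    gcongr

/-! ### Integrals of negative powers -/

/-- Integrability of a negative power from a power bound for the measure of sublevel sets. -/
theorem lintegral_rpow_neg_le_of_measure_le {X : Type*} [MeasurableSpace X] {μ : Measure X}
    {g : X → ℝ} (hg : AEMeasurable g μ) (hg0 : ∀ᵐ x ∂μ, 0 ≤ g x) {M : ENNReal} (hM : M ≠ ⊤)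
    {m β γ : ℝ} (hm : 0 < m) (hγ : 0 < γ) (hγβ : γ < β) (hμ : μ Set.univ ≤ M)
    (h : ∀ l, 0 < l → μ {x | g x ≤ l} ≤ M * ENNReal.ofReal ((l / m) ^ β)) :
    ∫⁻ x, ENNReal.ofReal (g x) ^ (-γ) ∂μ ≤
      M * ENNReal.ofReal (β / (β - γ) * m ^ (-γ)) := by
  have hβ : 0 < β := hγ.trans hγβ
  -- Letting l → 0 shows that the zero set is null. This is needed before passing to real powers: at
  -- a zero the extended power is ∞ while the real one is 0.
  have hpos : ∀ᵐ x ∂μ, 0 < g x := by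
    have h0 : μ {x | g x ≤ 0} = 0 := by
      have hlim : Filter.Tendsto (fun l : ℝ => M * ENNReal.ofReal ((l / m) ^ β))
          (nhdsWithin 0 (Set.Ioi 0)) (nhds (M * ENNReal.ofReal ((0 / m) ^ β))) := by
        refine ENNReal.Tendsto.const_mul ?_ (Or.inr hM)
        refine (ENNReal.continuous_ofReal.tendsto _).comp ?_
        refine Filter.Tendsto.mono_left ?_ nhdsWithin_le_nhds
        exact ((continuous_id.div_const m).rpow_const (fun _ => Or.inr hβ.le)).tendsto 0
      rw [zero_div, Real.zero_rpow hβ.ne', ENNReal.ofReal_zero, mul_zero] at hlim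
      refine le_antisymm (ge_of_tendsto hlim ?_) bot_le
      filter_upwards [self_mem_nhdsWithin] with l hl
      exact (measure_mono fun x (hx : g x ≤ 0) => hx.trans (le_of_lt hl)).trans (h l hl)
    filter_upwards [measure_eq_zero_iff_ae_notMem.1 h0] with x hx
    simpa using hx
  have e1 : ∫⁻ x, ENNReal.ofReal (g x) ^ (-γ) ∂μ = ∫⁻ x, ENNReal.ofReal (g x ^ (-γ)) ∂μ :=
    lintegral_congr_ae (by
      filter_upwards [hpos] with x hx
      exact ENNReal.ofReal_rpow_of_pos hx)
  rw [e1, lintegral_eq_lintegral_meas_le μ (by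
      filter_upwards [hg0] with x hx; exact Real.rpow_nonneg hx _) (hg.pow_const _)]
  -- In the layer-cake integral, T is the height at which the trivial bound M meets the bound from
  -- sublevel sets. The tail beyond T converges because β/γ > 1.
  set T : ℝ := m ^ (-γ) with hT
  have hT0 : 0 < T := Real.rpow_pos_of_pos hm _
  have hβγ : 0 < β - γ := sub_pos.2 hγβ
  have hbound : ∀ t : ℝ, 0 < t →
      μ {x | t ≤ g x ^ (-γ)} ≤ M * ENNReal.ofReal (m ^ (-β) * t ^ (-(β / γ))) := by
    intro t ht
    have hsub : μ {x | t ≤ g x ^ (-γ)} ≤ μ {x | g x ≤ t ^ (-(1 / γ))} := by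
      refine measure_mono_ae ?_
      filter_upwards [hpos] with x hx hxt
      have hxt : t ≤ g x ^ (-γ) := hxt
      have := Real.rpow_le_rpow_of_nonpos ht hxt (z := -(1 / γ)) (by
        rw [neg_nonpos]; positivity)
      rw [← Real.rpow_mul hx.le] at this
      have e : -γ * -(1 / γ) = 1 := by field_simp
      rw [e, Real.rpow_one] at this
      exact this
    refine hsub.trans ((h _ (Real.rpow_pos_of_pos ht _)).trans_eq ?_)
    congr 2
    rw [Real.div_rpow (Real.rpow_nonneg ht.le _) hm.le, ← Real.rpow_mul ht.le,
      Real.rpow_neg hm.le, div_eq_inv_mul]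
    congr 2
    field_simp
  have hsplit : Set.Ioi (0 : ℝ) = Set.Ioc 0 T ∪ Set.Ioi T :=
    (Set.Ioc_union_Ioi_eq_Ioi hT0.le).symm
  have ha : -(β / γ) < -1 := by
    rw [neg_lt_neg_iff, lt_div_iff₀ hγ]; linarith
  have hI1 : ∫⁻ t in Set.Ioc 0 T, μ {x | t ≤ g x ^ (-γ)} ≤ M * ENNReal.ofReal T := by
    calc ∫⁻ t in Set.Ioc 0 T, μ {x | t ≤ g x ^ (-γ)} ≤ ∫⁻ t in Set.Ioc 0 T, M :=
          lintegral_mono fun t => (measure_mono (Set.subset_univ _)).trans hμ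
      _ = M * ENNReal.ofReal T := by simp
  have hI2 : ∫⁻ t in Set.Ioi T, μ {x | t ≤ g x ^ (-γ)} ≤
      M * ENNReal.ofReal (γ / (β - γ) * T) := by
    calc ∫⁻ t in Set.Ioi T, μ {x | t ≤ g x ^ (-γ)}
        ≤ ∫⁻ t in Set.Ioi T, M * ENNReal.ofReal (m ^ (-β) * t ^ (-(β / γ))) :=
          setLIntegral_mono' measurableSet_Ioi fun t ht => hbound t (hT0.trans ht)
      _ = M * ∫⁻ t in Set.Ioi T, ENNReal.ofReal (m ^ (-β) * t ^ (-(β / γ))) :=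
          lintegral_const_mul' _ _ hM
      _ = M * ENNReal.ofReal (∫ t in Set.Ioi T, m ^ (-β) * t ^ (-(β / γ))) := by
          rw [ofReal_integral_eq_lintegral_ofReal]
          · exact (integrableOn_Ioi_rpow_of_lt ha hT0).const_mul _
          · filter_upwards [ae_restrict_mem measurableSet_Ioi] with t ht
            have : 0 < t := hT0.trans ht
            show 0 ≤ m ^ (-β) * t ^ (-(β / γ))
            positivity
      _ = M * ENNReal.ofReal (γ / (β - γ) * T) := by
          rw [integral_const_mul, integral_Ioi_rpow_of_lt ha hT0]
          congr 2
          rw [hT, ← Real.rpow_mul hm.le, mul_div_assoc', mul_neg, ← Real.rpow_add hm]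
          have e : -β + -γ * (-(β / γ) + 1) = -γ := by field_simp; ring
          rw [e]
          have h2 : -(β / γ) + 1 = -((β - γ) / γ) := by field_simp; ring
          rw [h2]
          field_simp
  rw [hsplit, lintegral_union measurableSet_Ioi (by
    rw [Set.disjoint_left]; intro t ht ht'; exact absurd ht.2 (not_le.2 ht'))]
  refine (add_le_add hI1 hI2).trans_eq ?_
  rw [← mul_add, ← ENNReal.ofReal_add hT0.le (by positivity)]
  congr 2
  field_simp
  ring

/-! ### Symmetry of iterated derivatives -/

/-- Evaluation at a fixed tuple is continuous and linear in the form, so it commutes with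
differentiation; identities between values can thus be differentiated. -/
theorem fderiv_multilinear_apply {E F : Type*} [NormedAddCommGroup E] [NormedSpace ℝ E]
    [NormedAddCommGroup F] [NormedSpace ℝ F] {n : ℕ}
    {G : E → ContinuousMultilinearMap ℝ (fun _ : Fin n => E) F} {x : E}
    (hG : DifferentiableAt ℝ G x) (u : E) (w : Fin n → E) :
    fderiv ℝ G x u w = fderiv ℝ (fun y => G y w) x u := by
  have h := ((ContinuousMultilinearMap.apply ℝ (fun _ : Fin n => E) F w).hasFDerivAt.comp x
    hG.hasFDerivAt).fderiv
  have e : (fun y => G y w) = (ContinuousMultilinearMap.apply ℝ (fun _ : Fin n => E) F w) ∘ G := rfl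
  rw [e, h]
  rfl

/-- The iterated derivative of order `n + 1` of a function of class `C^(n+1)` on an open set is
symmetric under transposition of two consecutive arguments. -/
theorem iteratedFDeriv_comp_swap_succ {E F : Type*} [NormedAddCommGroup E] [NormedSpace ℝ E]
    [NormedAddCommGroup F] [NormedSpace ℝ F] {f : E → F} {U : Set E} (hU : IsOpen U) (n : ℕ)
    (hf : ContDiffOn ℝ ((n + 1 : ℕ) : WithTop ℕ∞) f U) {x : E} (hx : x ∈ U) (i : Fin n)
    (v : Fin (n + 1) → E) :
    iteratedFDeriv ℝ (n + 1) f x (v ∘ Equiv.swap i.castSucc i.succ) =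
      iteratedFDeriv ℝ (n + 1) f x v := by
  induction n generalizing x with
  | zero => exact i.elim0
  | succ n ih =>
    have hfx : ContDiffAt ℝ ((n + 1 + 1 : ℕ) : WithTop ℕ∞) f x := hf.contDiffAt (hU.mem_nhds hx)
    have hdiff : DifferentiableAt ℝ (iteratedFDeriv ℝ (n + 1) f) x :=
      hfx.differentiableAt_iteratedFDeriv (by exact_mod_cast Nat.lt_succ_self _)
    cases i using Fin.cases with
    -- The transposition fixes the first slot, which carries the outermost derivative; differentiate
    -- the symmetry of one order lower, valid near x.
    | succ i =>
      rw [iteratedFDeriv_succ_apply_left, iteratedFDeriv_succ_apply_left]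
      set τ : Equiv.Perm (Fin (n + 1)) := Equiv.swap i.castSucc i.succ
      have h0 : (v ∘ Equiv.swap i.succ.castSucc i.succ.succ) 0 = v 0 := by
        rw [Function.comp_apply, Equiv.swap_apply_of_ne_of_ne]
        · rw [← Fin.succ_castSucc]; exact (Fin.succ_ne_zero _).symm
        · exact (Fin.succ_ne_zero _).symm
      have ht : Fin.tail (v ∘ Equiv.swap i.succ.castSucc i.succ.succ) = Fin.tail v ∘ τ := by
        funext j
        simp only [Fin.tail, Function.comp_apply, ← Fin.succ_castSucc, τ]
        rw [Fin.succ_injective _ |>.swap_apply]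
      rw [h0, ht]
      rw [fderiv_multilinear_apply hdiff, fderiv_multilinear_apply hdiff]
      congr 1
      refine Filter.EventuallyEq.fderiv_eq ?_
      filter_upwards [hU.mem_nhds hx] with y hy
      exact ih (hf.of_le (by exact_mod_cast Nat.le_succ _)) hy i _
    -- The first two slots are the second derivative of D^n f, which is C², so its symmetry applies.
    | zero =>
      set g := iteratedFDeriv ℝ n f with hg
      have hg2 : ContDiffAt ℝ 2 g x := hfx.iteratedFDeriv_right (by norm_cast; omega)
      have hsymm := hg2.isSymmSndFDerivAt (by simp)
      have key : ∀ w : Fin (n + 1 + 1) → E, iteratedFDeriv ℝ (n + 1 + 1) f x w =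
          fderiv ℝ (fderiv ℝ g) x (w 0) (w 1) (Fin.tail (Fin.tail w)) := by
        intro w
        have hdg : DifferentiableAt ℝ (fderiv ℝ g) x :=
          (hg2.fderiv_right (m := 1) (by norm_num)).differentiableAt (by norm_num)
        have h2 := hdg.hasFDerivAt.clm_apply (hasFDerivAt_const (w 1) x)
        have e2 : (fun y => iteratedFDeriv ℝ (n + 1) f y (Fin.tail w)) =
            fun y => fderiv ℝ g y (w 1) (Fin.tail (Fin.tail w)) := by
          funext y
          rw [iteratedFDeriv_succ_apply_left]
          rfl
        rw [iteratedFDeriv_succ_apply_left, fderiv_multilinear_apply hdiff, e2,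
          ← fderiv_multilinear_apply (G := fun y => fderiv ℝ g y (w 1)) h2.differentiableAt,
          h2.fderiv]
        simp
      rw [key, key]
      have ht : Fin.tail (Fin.tail (v ∘ Equiv.swap (Fin.castSucc 0) (Fin.succ 0))) =
          Fin.tail (Fin.tail v) := by
        funext j
        simp only [Fin.tail, Function.comp_apply]
        rw [Equiv.swap_apply_of_ne_of_ne]
        · exact Fin.succ_ne_zero _
        · exact fun h => Fin.succ_ne_zero _ (Fin.succ_injective _ h)
      rw [ht, Function.comp_apply, Function.comp_apply]
      have e0 : Equiv.swap (Fin.castSucc (0 : Fin (n + 1))) (Fin.succ 0) 0 = 1 :=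
        Equiv.swap_apply_left _ _
      have e1 : Equiv.swap (Fin.castSucc (0 : Fin (n + 1))) (Fin.succ 0) 1 = 0 :=
        Equiv.swap_apply_right _ _
      rw [e0, e1, hsymm.eq]

/-- The `n`-th iterated derivative of a function of class `C^n` on an open set is symmetric. -/
theorem iteratedFDeriv_comp_perm_of_contDiffOn {E F : Type*} [NormedAddCommGroup E]
    [NormedSpace ℝ E] [NormedAddCommGroup F] [NormedSpace ℝ F] {f : E → F} {U : Set E}
    (hU : IsOpen U) {n : ℕ} (hf : ContDiffOn ℝ (n : WithTop ℕ∞) f U) {x : E} (hx : x ∈ U)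
    (v : Fin n → E) (π : Equiv.Perm (Fin n)) :
    iteratedFDeriv ℝ n f x (v ∘ π) = iteratedFDeriv ℝ n f x v := by
  rcases n with _ | n
  · congr 1; exact Subsingleton.elim _ _
  have hπ : π ∈ Submonoid.closure (Set.range fun i : Fin n => Equiv.swap i.castSucc i.succ) := by
    rw [Equiv.Perm.mclosure_swap_castSucc_succ]; trivial
  induction hπ using Submonoid.closure_induction generalizing v with
  | mem π h =>
    obtain ⟨i, rfl⟩ := h
    exact iteratedFDeriv_comp_swap_succ hU n hf hx i v
  | one => rfl
  | mul π τ _ _ h1 h2 => rw [Equiv.Perm.coe_mul, ← Function.comp_assoc, h2, h1]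

/-! ### The diagonal norm and polarization -/

section DiagNorm

variable {N l : ℕ}

theorem diagNorm_nonneg
    (Λ : ContinuousMultilinearMap ℝ (fun _ : Fin l => EuclideanSpace ℝ (Fin N)) ℝ) :
    0 ≤ diagNorm Λ :=
  Real.iSup_nonneg fun _ => abs_nonneg _

theorem abs_apply_le_diagNorm
    (Λ : ContinuousMultilinearMap ℝ (fun _ : Fin l => EuclideanSpace ℝ (Fin N)) ℝ)
    {v : EuclideanSpace ℝ (Fin N)} (hv : ‖v‖ ≤ 1) : |Λ fun _ => v| ≤ diagNorm Λ :=
  le_ciSup (diagNorm_bddAbove Λ) (⟨v, mem_closedBall_zero_iff.2 hv⟩ : Metric.closedBall _ _)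

theorem diagNorm_le
    (Λ : ContinuousMultilinearMap ℝ (fun _ : Fin l => EuclideanSpace ℝ (Fin N)) ℝ) {C : ℝ}
    (h : ∀ v : EuclideanSpace ℝ (Fin N), ‖v‖ ≤ 1 → |Λ fun _ => v| ≤ C) : diagNorm Λ ≤ C :=
  haveI : Nonempty (Metric.closedBall (0 : EuclideanSpace ℝ (Fin N)) 1) :=
    ⟨⟨0, Metric.mem_closedBall_self zero_le_one⟩⟩
  ciSup_le fun v => h v (mem_closedBall_zero_iff.1 v.2)

/-- Giving up a factor 2 avoids proving that the supremum is attained, and the estimate remains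
valid when the norm is zero. -/
theorem exists_half_diagNorm_le
    (Λ : ContinuousMultilinearMap ℝ (fun _ : Fin l => EuclideanSpace ℝ (Fin N)) ℝ) :
    ∃ v : EuclideanSpace ℝ (Fin N), ‖v‖ ≤ 1 ∧ diagNorm Λ / 2 ≤ |Λ fun _ => v| := by
  by_contra! h
  have h0 := h 0 (by simp)
  have h1 := diagNorm_le Λ fun v hv => (h v hv).le
  have h2 := abs_nonneg (Λ fun _ => (0 : EuclideanSpace ℝ (Fin N)))
  linarith

theorem diagNorm_le_norm
    (Λ : ContinuousMultilinearMap ℝ (fun _ : Fin l => EuclideanSpace ℝ (Fin N)) ℝ) :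
    diagNorm Λ ≤ ‖Λ‖ := by
  refine diagNorm_le Λ fun v hv => ?_
  have h := Λ.le_opNorm (fun _ => v)
  rw [Real.norm_eq_abs] at h
  exact h.trans (mul_le_of_le_one_right (norm_nonneg _)
    (Finset.prod_le_one (fun _ _ => norm_nonneg _) (fun _ _ => hv)))

theorem diagNorm_add_le
    (Λ Γ : ContinuousMultilinearMap ℝ (fun _ : Fin l => EuclideanSpace ℝ (Fin N)) ℝ) :
    diagNorm (Λ + Γ) ≤ diagNorm Λ + diagNorm Γ :=
  diagNorm_le _ fun _ hv => (abs_add_le _ _).trans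
    (add_le_add (abs_apply_le_diagNorm Λ hv) (abs_apply_le_diagNorm Γ hv))

theorem continuous_diagNorm : Continuous
    (diagNorm : ContinuousMultilinearMap ℝ (fun _ : Fin l => EuclideanSpace ℝ (Fin N)) ℝ → ℝ) := by
  refine (LipschitzWith.of_le_add fun Λ Γ => ?_).continuous
  have h := (diagNorm_add_le Γ (Λ - Γ)).trans (add_le_add le_rfl (diagNorm_le_norm (Λ - Γ)))
  rwa [add_sub_cancel, ← dist_eq_norm] at h

theorem abs_apply_self_le_diagNorm_mul_pow
    (Λ : ContinuousMultilinearMap ℝ (fun _ : Fin l => EuclideanSpace ℝ (Fin N)) ℝ)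
    {v : EuclideanSpace ℝ (Fin N)} {R : ℝ} (hR : 0 < R) (hv : ‖v‖ ≤ R) :
    |Λ fun _ => v| ≤ R ^ l * diagNorm Λ := by
  have h := abs_apply_le_diagNorm Λ (v := R⁻¹ • v) (by
    rw [norm_smul, norm_inv, Real.norm_of_nonneg hR.le, inv_mul_le_iff₀ hR]; simpa using hv)
  have e : (fun _ : Fin l => v) = fun i => (fun _ : Fin l => R) i • (fun _ => R⁻¹ • v) i := by
    funext i; simp [smul_smul, hR.ne']
  rw [e, Λ.map_smul_univ]
  simp only [Finset.prod_const, Finset.card_univ, Fintype.card_fin, smul_eq_mul, abs_mul, abs_pow,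
    abs_of_pos hR]
  gcongr

/-- Polarization: the value of a symmetric form in terms of its values on the diagonal. -/
theorem factorial_mul_apply_eq_sum {E : Type*} [AddCommGroup E] [Module ℝ E]
    (Λ : MultilinearMap ℝ (fun _ : Fin l => E) ℝ)
    (hΛ : ∀ (v : Fin l → E) (π : Equiv.Perm (Fin l)), Λ (v ∘ π) = Λ v) (v : Fin l → E) :
    (l.factorial : ℝ) * Λ v =
      ∑ t : Finset (Fin l), (-1 : ℤ) ^ t.card • Λ (fun _ => ∑ j ∈ tᶜ, v j) := by
  classical
  -- Inclusion–exclusion over the maps r that miss an index i: those missing none are the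
  -- permutations, and those missing all of t are the maps into tᶜ, whose sum is the multilinear
  -- expansion of the diagonal value at ∑ v j over tᶜ.
  have h := Finset.inclusion_exclusion_sum_inf_compl (Finset.univ : Finset (Fin l))
    (fun i => Finset.univ.filter fun r : Fin l → Fin l => ∀ j, r j ≠ i) (fun r => Λ (v ∘ r))
  have hL : (Finset.univ : Finset (Fin l)).inf
      (fun i => (Finset.univ.filter fun r : Fin l → Fin l => ∀ j, r j ≠ i)ᶜ) =
      Finset.univ.map ⟨fun π : Equiv.Perm (Fin l) => (π : Fin l → Fin l),
        fun _ _ h => Equiv.coe_fn_injective h⟩ := by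
    ext r
    simp only [Finset.mem_inf, Finset.mem_univ, Finset.mem_compl, Finset.mem_filter, true_and,
      forall_const, Finset.mem_map, not_forall, not_not]
    constructor
    · intro hr
      exact ⟨Equiv.ofBijective r (Finite.surjective_iff_bijective.1 hr), rfl⟩
    · rintro ⟨π, rfl⟩ i
      exact π.surjective i
  rw [hL, Finset.sum_map] at h
  have hp : ∑ π : Equiv.Perm (Fin l), Λ (v ∘ π) = l.factorial * Λ v := by
    simp [hΛ, Fintype.card_perm]
  rw [Finset.powerset_univ] at h
  refine hp.symm.trans (h.trans ?_)
  refine Finset.sum_congr rfl fun t _ => ?_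
  congr 1
  have hR : t.inf (fun i => Finset.univ.filter fun r : Fin l → Fin l => ∀ j, r j ≠ i) =
      Fintype.piFinset fun _ => tᶜ := by
    ext r
    simp only [Finset.mem_inf, Finset.mem_filter, Finset.mem_univ, true_and, Fintype.mem_piFinset,
      Finset.mem_compl]
    exact ⟨fun h j hj => h _ hj j rfl, fun h i hi j hj => h j (hj ▸ hi)⟩
  rw [hR, Λ.map_sum_finset (fun _ j => v j)]
  rfl

/-- The operator norm of a symmetric form is controlled by its supremum on the diagonal. -/
theorem norm_le_diagNorm
    (Λ : ContinuousMultilinearMap ℝ (fun _ : Fin l => EuclideanSpace ℝ (Fin N)) ℝ)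
    (hΛ : ∀ (v : Fin l → EuclideanSpace ℝ (Fin N)) (π : Equiv.Perm (Fin l)), Λ (v ∘ π) = Λ v) :
    ‖Λ‖ ≤ 2 ^ l * (l + 1) ^ l * diagNorm Λ := by
  have hunit : ∀ v : Fin l → EuclideanSpace ℝ (Fin N), (∀ i, ‖v i‖ ≤ 1) →
      |Λ v| ≤ 2 ^ l * (l + 1) ^ l * diagNorm Λ := by
    intro v hv
    have h := factorial_mul_apply_eq_sum Λ.toMultilinearMap hΛ v
    have h1 : |Λ v| ≤ |(l.factorial : ℝ) * Λ v| := by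
      rw [abs_mul, Nat.abs_cast]
      exact le_mul_of_one_le_left (abs_nonneg _) (by exact_mod_cast l.factorial_pos)
    refine h1.trans ?_
    change (l.factorial : ℝ) * Λ v = _ at h
    rw [h]
    refine (Finset.abs_sum_le_sum_abs _ _).trans ?_
    have h2 : ∀ t ∈ (Finset.univ : Finset (Finset (Fin l))),
        |(-1 : ℤ) ^ t.card • Λ.toMultilinearMap (fun _ => ∑ j ∈ tᶜ, v j)| ≤
          ((l : ℝ) + 1) ^ l * diagNorm Λ := by
      intro t _
      have e : |(-1 : ℤ) ^ t.card • Λ.toMultilinearMap (fun _ => ∑ j ∈ tᶜ, v j)| =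
          |Λ (fun _ => ∑ j ∈ tᶜ, v j)| := by
        rw [zsmul_eq_mul, abs_mul]
        push_cast
        rw [abs_pow, abs_neg, abs_one, one_pow, one_mul]
        rfl
      rw [e]
      -- The radius l + 1 instead of l stays positive for l = 0.
      refine abs_apply_self_le_diagNorm_mul_pow Λ (by positivity) ?_
      refine (norm_sum_le _ _).trans ((Finset.sum_le_card_nsmul _ _ 1 fun i _ => hv i).trans ?_)
      have : (tᶜ.card : ℝ) ≤ l := by
        have := Finset.card_le_univ tᶜ
        rw [Fintype.card_fin] at this
        exact_mod_cast this
      rw [nsmul_eq_mul, mul_one]; linarith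
    refine (Finset.sum_le_sum h2).trans_eq ?_
    simp [mul_assoc]
  refine ContinuousMultilinearMap.opNorm_le_bound
    (mul_nonneg (by positivity) (diagNorm_nonneg Λ)) fun v => ?_
  by_cases h0 : ∃ i, v i = 0
  · obtain ⟨i, hi⟩ := h0
    rw [Λ.map_coord_zero i hi, norm_zero]
    exact mul_nonneg (mul_nonneg (by positivity) (diagNorm_nonneg Λ))
      (Finset.prod_nonneg fun _ _ => norm_nonneg _)
  push Not at h0
  have e : v = fun i => ‖v i‖ • (‖v i‖⁻¹ • v i) := by
    funext i; rw [smul_smul, mul_inv_cancel₀ (norm_ne_zero_iff.2 (h0 i)), one_smul]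
  have h := hunit (fun i => ‖v i‖⁻¹ • v i) (fun i => by
    rw [norm_smul, norm_inv, norm_norm, inv_mul_cancel₀ (norm_ne_zero_iff.2 (h0 i))])
  conv_lhs => rw [e]
  rw [Λ.map_smul_univ (fun i => ‖v i‖) (fun i => ‖v i‖⁻¹ • v i), norm_smul, mul_comm,
    Real.norm_of_nonneg (Finset.prod_nonneg fun _ _ => norm_nonneg _), Real.norm_eq_abs]
  gcongr

end DiagNorm

/-! ### Variation of derivatives and sublevel sets on balls -/

section Variation

variable {N k : ℕ} {α H : ℝ} {U : Set (EuclideanSpace ℝ (Fin N))}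
  {a : EuclideanSpace ℝ (Fin N) → ℝ}

/-- Variation of the derivatives of `a` on a ball, in terms of the derivatives at the centre. -/
theorem pow_mul_norm_iteratedFDeriv_sub_le (hU : IsOpen U)
    (ha : ContDiffOn ℝ (k : WithTop ℕ∞) a U) (hα : 0 < α) (hH0 : 0 ≤ H)
    (hH : ∀ x ∈ U, ∀ y ∈ U,
      ‖iteratedFDeriv ℝ k a x - iteratedFDeriv ℝ k a y‖ ≤ H * ‖x - y‖ ^ α)
    {x : EuclideanSpace ℝ (Fin N)} {ρ : ℝ} (hρ : 0 < ρ) (hx : Metric.ball x ρ ⊆ U) {i : ℕ}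
    (hi : i ≤ k) : ∀ z ∈ Metric.ball x ρ,
      ρ ^ i * ‖iteratedFDeriv ℝ i a z - iteratedFDeriv ℝ i a x‖ ≤
        ∑ j ∈ Finset.Ioc i k, ‖iteratedFDeriv ℝ j a x‖ * ρ ^ j + H * ρ ^ ((k : ℝ) + α) := by
  have hxx : x ∈ Metric.ball x ρ := Metric.mem_ball_self hρ
  -- Downward induction from the Hölder bound at order k: the mean value inequality passes from
  -- D^(i+1) to D^i, and each step adds the single term ‖D^(i+1) a(x)‖ ρ^(i+1).
  induction hi using Nat.decreasingInduction with
  | self =>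
    intro z hz
    rw [Finset.Ioc_self, Finset.sum_empty, zero_add, Real.rpow_add hρ, Real.rpow_natCast]
    have h := hH z (hx hz) x (hx hxx)
    have h2 : ‖z - x‖ ^ α ≤ ρ ^ α :=
      Real.rpow_le_rpow (norm_nonneg _) (mem_ball_iff_norm.1 hz).le hα.le
    calc ρ ^ k * ‖iteratedFDeriv ℝ k a z - iteratedFDeriv ℝ k a x‖
        ≤ ρ ^ k * (H * ρ ^ α) := by gcongr; exact h.trans (by gcongr)
      _ = _ := by ring
  | of_succ i hi ih =>
    intro z hz
    set B := ∑ j ∈ Finset.Ioc i k, ‖iteratedFDeriv ℝ j a x‖ * ρ ^ j + H * ρ ^ ((k : ℝ) + α) with hB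
    have hsum : ∑ j ∈ Finset.Ioc i k, ‖iteratedFDeriv ℝ j a x‖ * ρ ^ j =
        ‖iteratedFDeriv ℝ (i + 1) a x‖ * ρ ^ (i + 1) +
          ∑ j ∈ Finset.Ioc (i + 1) k, ‖iteratedFDeriv ℝ j a x‖ * ρ ^ j := by
      rw [← Finset.sum_insert (f := fun j => ‖iteratedFDeriv ℝ j a x‖ * ρ ^ j) (by simp)]
      congr 1
      exact (Finset.insert_Ioc_add_one_left_eq_Ioc hi).symm
    have hbound : ∀ y ∈ Metric.ball x ρ, ‖fderiv ℝ (iteratedFDeriv ℝ i a) y‖ ≤ B / ρ ^ (i + 1) := by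
      intro y hy
      rw [norm_fderiv_iteratedFDeriv, le_div_iff₀ (by positivity)]
      have h1 : ‖iteratedFDeriv ℝ (i + 1) a y‖ ≤ ‖iteratedFDeriv ℝ (i + 1) a x‖ +
          ‖iteratedFDeriv ℝ (i + 1) a y - iteratedFDeriv ℝ (i + 1) a x‖ := norm_le_insert' _ _
      have h2 := ih y hy
      have h3 : (0 : ℝ) < ρ ^ (i + 1) := by positivity
      rw [hB, hsum]
      nlinarith
    have hmv := (convex_ball x ρ).norm_image_sub_le_of_norm_fderiv_le (𝕜 := ℝ)
      (fun y hy => (ha.contDiffAt (hU.mem_nhds (hx hy))).differentiableAt_iteratedFDeriv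
        (by exact_mod_cast hi)) hbound hxx hz
    have hB0 : 0 ≤ B := by positivity
    calc ρ ^ i * ‖iteratedFDeriv ℝ i a z - iteratedFDeriv ℝ i a x‖
        ≤ ρ ^ i * (B / ρ ^ (i + 1) * ρ) := by
          gcongr
          exact hmv.trans (by gcongr; exact (mem_ball_iff_norm.1 hz).le)
      _ = B := by field_simp; ring

theorem pow_mul_norm_iteratedFDeriv_le (hU : IsOpen U)
    (ha : ContDiffOn ℝ (k : WithTop ℕ∞) a U) (hα : 0 < α) (hH0 : 0 ≤ H)
    (hH : ∀ x ∈ U, ∀ y ∈ U,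
      ‖iteratedFDeriv ℝ k a x - iteratedFDeriv ℝ k a y‖ ≤ H * ‖x - y‖ ^ α)
    {x : EuclideanSpace ℝ (Fin N)} {ρ : ℝ} (hρ : 0 < ρ) (hx : Metric.ball x ρ ⊆ U) {i : ℕ}
    (hi : i ≤ k) {z : EuclideanSpace ℝ (Fin N)} (hz : z ∈ Metric.ball x ρ) :
    ρ ^ i * ‖iteratedFDeriv ℝ i a z‖ ≤
      ∑ j ∈ Finset.range (k + 1), ‖iteratedFDeriv ℝ j a x‖ * ρ ^ j + H * ρ ^ ((k : ℝ) + α) := by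
  have h := pow_mul_norm_iteratedFDeriv_sub_le hU ha hα hH0 hH hρ hx hi z hz
  have h1 : ‖iteratedFDeriv ℝ i a z‖ ≤ ‖iteratedFDeriv ℝ i a x‖ +
      ‖iteratedFDeriv ℝ i a z - iteratedFDeriv ℝ i a x‖ := norm_le_insert' _ _
  have h2 : ‖iteratedFDeriv ℝ i a x‖ * ρ ^ i +
      ∑ j ∈ Finset.Ioc i k, ‖iteratedFDeriv ℝ j a x‖ * ρ ^ j ≤
        ∑ j ∈ Finset.range (k + 1), ‖iteratedFDeriv ℝ j a x‖ * ρ ^ j := by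
    rw [← Finset.sum_insert (f := fun j => ‖iteratedFDeriv ℝ j a x‖ * ρ ^ j) (by simp)]
    refine Finset.sum_le_sum_of_subset_of_nonneg ?_ fun _ _ _ => by positivity
    intro j hj
    simp only [Finset.mem_insert, Finset.mem_Ioc, Finset.mem_range] at hj ⊢
    omega
  have h3 : (0 : ℝ) < ρ ^ i := by positivity
  nlinarith

/-- Sublevel estimate on a ball on which one pure directional derivative is bounded below. -/
theorem volume_ball_sublevel_le (hU : IsOpen U) (ha : ContDiffOn ℝ (k : WithTop ℕ∞) a U)
    {x v : EuclideanSpace ℝ (Fin N)} {ρ : ℝ} (hρ : 0 < ρ) (hx : Metric.ball x ρ ⊆ U) {i : ℕ}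
    (hi : i ≤ k) (hv : ‖v‖ ≤ 1) {s c β l : ℝ} (hs : |s| = 1) (hc : 0 < c) (hβ : 0 < β)
    (hβi : β * i ≤ 1) (hl : 0 < l)
    (h : ∀ z ∈ Metric.ball x ρ, c ≤ s * iteratedFDeriv ℝ i a z (fun _ => v)) :
    volume {z | z ∈ Metric.ball x ρ ∧ |a z| ≤ l} ≤
      ENNReal.ofReal (2 ^ (N + i + 1) * (l / (c * (2 * ρ) ^ i)) ^ β) *
        volume (Metric.ball x ρ) := by
  set E : Set (EuclideanSpace ℝ (Fin N)) := {z | z ∈ Metric.ball x ρ ∧ |a z| ≤ l} with hE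
  have hEm : MeasurableSet E := by
    have : E = Metric.ball x ρ \ (Metric.ball x ρ ∩ (fun z => |a z|) ⁻¹' Set.Ioi l) := by
      ext z
      simp only [hE, Set.mem_ofPred_eq, Set.mem_sdiff, Set.mem_inter_iff, Set.mem_preimage,
        Set.mem_Ioi, not_and, not_lt]
      tauto
    rw [this]
    exact Metric.isOpen_ball.measurableSet.diff
      ((ha.continuousOn.mono hx).abs.isOpen_inter_preimage Metric.isOpen_ball
        isOpen_Ioi).measurableSet
  set D : ℝ := 2 ^ (i + 1) * (2 * ρ) * (l / (c * (2 * ρ) ^ i)) ^ β with hD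
  have hD0 : 0 ≤ D := by positivity
  -- Fubini is applied to the translates of E along v rather than in rotated coordinates: each line
  -- costs at most D, and only z within 2ρ of x contribute, since a displacement has length at most
  -- ρ.
  have hline : ∀ z, volume {t : ℝ | t ∈ Set.Ioo (-ρ) ρ ∧ z + t • v ∈ E} ≤
      (Metric.ball x (2 * ρ)).indicator (fun _ => ENNReal.ofReal D) z := by
    intro z
    by_cases hz : z ∈ Metric.ball x (2 * ρ)
    swap
    · have : {t : ℝ | t ∈ Set.Ioo (-ρ) ρ ∧ z + t • v ∈ E} = ∅ := by
        refine Set.eq_empty_of_forall_notMem fun t ht => hz ?_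
        have h1 : ‖z + t • v - x‖ < ρ := mem_ball_iff_norm.1 ht.2.1
        have h2 : ‖t • v‖ ≤ ρ := by
          rw [norm_smul, Real.norm_eq_abs]
          calc |t| * ‖v‖ ≤ ρ * 1 := by
                gcongr
                exact (abs_lt.2 ht.1).le
            _ = ρ := mul_one ρ
        rw [mem_ball_iff_norm]
        calc ‖z - x‖ = ‖(z + t • v - x) - t • v‖ := by congr 1; abel
          _ ≤ ‖z + t • v - x‖ + ‖t • v‖ := norm_sub_le _ _
          _ < 2 * ρ := by linarith
      rw [this, measure_empty]; exact bot_le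
    rw [Set.indicator_of_mem hz]
    set J : Set ℝ := {t | t ∈ Set.Ioo (-ρ) ρ ∧ z + t • v ∈ Metric.ball x ρ} with hJ
    have hJc : J.OrdConnected := by
      have e : J = Set.Ioo (-ρ) ρ ∩ AffineMap.lineMap (k := ℝ) z (z + v) ⁻¹' Metric.ball x ρ := by
        ext t
        simp [hJ, AffineMap.lineMap_apply, add_comm]
      rw [e]
      exact ((convex_Ioo _ _).inter ((convex_ball x ρ).affine_preimage _)).ordConnected
    have hJL : volume J ≤ ENNReal.ofReal (2 * ρ) := by
      refine (measure_mono fun t ht => ht.1).trans_eq ?_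
      rw [Real.volume_Ioo]; congr 1; ring
    have hmain := volume_sublevel_le_rpow i hβ hβi
      (fun j t => s * iteratedFDeriv ℝ j a (z + t • v) (fun _ => v)) J hJc hc hl
      (by positivity : (0 : ℝ) < 2 * ρ) hJL ?_ (fun t ht => h _ ht.2)
    · refine (measure_mono fun t ht => ?_).trans hmain
      refine ⟨⟨ht.1, ht.2.1⟩, ?_⟩
      simp only [iteratedFDeriv_zero_apply, abs_mul, hs, one_mul]
      exact ht.2.2
    · intro j hj t ht
      have hd : DifferentiableAt ℝ (iteratedFDeriv ℝ j a) (z + t • v) :=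
        (ha.contDiffAt (hU.mem_nhds (hx ht.2))).differentiableAt_iteratedFDeriv
          (by exact_mod_cast hj.trans_le hi)
      have h1 : HasDerivAt (fun t : ℝ => z + t • v) v t := by
        simpa using ((hasDerivAt_id t).smul_const v).const_add z
      have h2 := hd.hasFDerivAt.comp_hasDerivAt t h1
      have h3 := ((ContinuousMultilinearMap.apply ℝ (fun _ : Fin j => EuclideanSpace ℝ (Fin N)) ℝ
        (fun _ => v)).hasFDerivAt.comp_hasDerivAt t h2).const_mul s
      exact h3
  have hcalc : volume E * ENNReal.ofReal (2 * ρ) ≤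
      ENNReal.ofReal D * volume (Metric.ball x (2 * ρ)) := by
    have hmeas : Measurable (Function.uncurry fun (t : ℝ) (z : EuclideanSpace ℝ (Fin N)) =>
        E.indicator (1 : EuclideanSpace ℝ (Fin N) → ENNReal) (z + t • v)) :=
      (measurable_one.indicator hEm).comp
        (by fun_prop : Continuous fun p : ℝ × EuclideanSpace ℝ (Fin N) => p.2 + p.1 • v).measurable
    calc volume E * ENNReal.ofReal (2 * ρ)
        = ∫⁻ _ in Set.Ioo (-ρ) ρ, volume E := by
          rw [setLIntegral_const, Real.volume_Ioo]; congr 2; ring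
      _ = ∫⁻ t in Set.Ioo (-ρ) ρ, ∫⁻ z, E.indicator (1 : EuclideanSpace ℝ (Fin N) → ENNReal) (z + t • v) := by
          congr 1; funext t
          rw [lintegral_add_right_eq_self (E.indicator (1 : EuclideanSpace ℝ (Fin N) → ENNReal)) (t • v),
            lintegral_indicator_one hEm]
      _ = ∫⁻ z, ∫⁻ t in Set.Ioo (-ρ) ρ, E.indicator (1 : EuclideanSpace ℝ (Fin N) → ENNReal) (z + t • v) :=
          lintegral_lintegral_swap hmeas.aemeasurable
      _ ≤ ∫⁻ z, (Metric.ball x (2 * ρ)).indicator (fun _ => ENNReal.ofReal D) z := by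
          refine lintegral_mono fun z => le_trans (le_of_eq ?_) (hline z)
          have hm : MeasurableSet {t : ℝ | z + t • v ∈ E} :=
            hEm.preimage (by fun_prop : Continuous fun t : ℝ => z + t • v).measurable
          have : (fun t : ℝ => E.indicator (1 : EuclideanSpace ℝ (Fin N) → ENNReal) (z + t • v)) =
              {t : ℝ | z + t • v ∈ E}.indicator 1 := rfl
          rw [this, lintegral_indicator_one hm, Measure.restrict_apply hm, Set.inter_comm]
          rfl
      _ = ENNReal.ofReal D * volume (Metric.ball x (2 * ρ)) := by
          rw [lintegral_indicator_const Metric.isOpen_ball.measurableSet]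
  have hvol : volume (Metric.ball x (2 * ρ)) = ENNReal.ofReal (2 ^ N) * volume (Metric.ball x ρ) := by
    rw [Measure.addHaar_ball_mul_of_pos volume x two_pos, finrank_euclideanSpace_fin,
      Measure.addHaar_ball_center volume x ρ]
  rw [hvol] at hcalc
  have hL0 : ENNReal.ofReal (2 * ρ) ≠ 0 := by
    rw [Ne, ENNReal.ofReal_eq_zero]; linarith
  rw [← ENNReal.le_div_iff_mul_le (Or.inl hL0) (Or.inl ENNReal.ofReal_ne_top)] at hcalc
  refine hcalc.trans_eq ?_
  rw [← mul_assoc, ENNReal.div_eq_inv_mul, ← mul_assoc, ← ENNReal.ofReal_mul hD0,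
    ← ENNReal.ofReal_inv_of_pos (by positivity), ← ENNReal.ofReal_mul (by positivity)]
  congr 2
  rw [hD]
  field_simp
  ring

end Variation

/-! ### Small Hölder remainder: lower bounds and integrability -/

/-- A nonnegative function of class `C^{k,α}` on `U` with Hölder constant `H` in operator norm,
together with a constant `K` comparing the operator norm with the norm on the diagonal. -/
structure HolderData {N : ℕ} (k : ℕ) (α H K : ℝ) (U : Set (EuclideanSpace ℝ (Fin N)))
    (a : EuclideanSpace ℝ (Fin N) → ℝ) : Prop where
  isOpen : IsOpen U
  contDiffOn : ContDiffOn ℝ (k : WithTop ℕ∞) a U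
  nonneg : ∀ x ∈ U, 0 ≤ a x
  exponent_pos : 0 < α
  constant_nonneg : 0 ≤ H
  holder : ∀ x ∈ U, ∀ y ∈ U,
    ‖iteratedFDeriv ℝ k a x - iteratedFDeriv ℝ k a y‖ ≤ H * ‖x - y‖ ^ α
  one_le : 1 ≤ K
  norm_le : ∀ i ≤ k, ∀ x ∈ U, ‖iteratedFDeriv ℝ i a x‖ ≤ K * diagNorm (iteratedFDeriv ℝ i a x)

/-- The size of the derivatives of `a` at `x` at scale `ρ`. -/
noncomputable def derivSize {N : ℕ} (k : ℕ) (a : EuclideanSpace ℝ (Fin N) → ℝ) (x : EuclideanSpace ℝ (Fin N))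
    (ρ : ℝ) : ℝ :=
  ∑ j ∈ Finset.range (k + 1), ‖iteratedFDeriv ℝ j a x‖ * ρ ^ j

theorem norm_mul_pow_le_derivSize {N k : ℕ} {a : EuclideanSpace ℝ (Fin N) → ℝ}
    {x : EuclideanSpace ℝ (Fin N)} {ρ : ℝ} (hρ : 0 ≤ ρ) {i : ℕ} (hi : i ≤ k) :
    ‖iteratedFDeriv ℝ i a x‖ * ρ ^ i ≤ derivSize k a x ρ :=
  Finset.single_le_sum (f := fun j => ‖iteratedFDeriv ℝ j a x‖ * ρ ^ j)
    (fun _ _ => by positivity) (Finset.mem_range.2 (Nat.lt_succ_of_le hi))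

namespace HolderData

variable {N k : ℕ} {α H K : ℝ} {U : Set (EuclideanSpace ℝ (Fin N))}
  {a : EuclideanSpace ℝ (Fin N) → ℝ}

/-- If the Hölder remainder is small compared with the derivatives at the centre of a ball, some
pure directional derivative of `a` is bounded below on the whole ball. -/
theorem exists_directional_lower_bound (h : HolderData k α H K U a) {A : ℝ}
    (hA : A = 4 * K * (k + 1)) {x : EuclideanSpace ℝ (Fin N)} {ρ : ℝ} (hρ : 0 < ρ)
    (hx : Metric.ball x ρ ⊆ U) (hm : 0 < derivSize k a x ρ)
    (hsmall : H * ρ ^ ((k : ℝ) + α) ≤ 1 / (A ^ (k + 1) * (k + 1)) * derivSize k a x ρ) :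
    ∃ i ≤ k, ∃ v : EuclideanSpace ℝ (Fin N), ‖v‖ ≤ 1 ∧ ∃ s c : ℝ, |s| = 1 ∧
      derivSize k a x ρ / A ^ (k + 1) ≤ c * ρ ^ i ∧
      ∀ z ∈ Metric.ball x ρ, c ≤ s * iteratedFDeriv ℝ i a z (fun _ => v) := by
  have hK0 : 0 < K := zero_lt_one.trans_le h.one_le
  have hk1 : (1 : ℝ) ≤ k + 1 := by linarith [(Nat.cast_nonneg k : (0 : ℝ) ≤ k)]
  have hA1 : 1 ≤ A := by rw [hA]; nlinarith [h.one_le]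
  have hA0 : 0 < A := zero_lt_one.trans_le hA1
  set q : ℕ → ℝ := fun j => ‖iteratedFDeriv ℝ j a x‖ * ρ ^ j with hq
  have hq0 : ∀ j, 0 ≤ q j := fun j => by positivity
  set m := derivSize k a x ρ with hmdef
  have hmq : m = ∑ j ∈ Finset.range (k + 1), q j := rfl
  -- The weights A^j favour high orders: at a maximizer i every higher term is at most q i / A,
  -- while q i is still at least m / ((k+1) A^k). The choice A = 4K(k+1) makes the at most k higher
  -- terms and the remainder add up to q i / (4K).
  obtain ⟨i, hi, hmax⟩ := Finset.exists_max_image (Finset.range (k + 1)) (fun j => A ^ j * q j)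
    ⟨0, by simp⟩
  have hik : i ≤ k := Nat.lt_succ_iff.1 (Finset.mem_range.1 hi)
  have hmle : m ≤ (k + 1) * (A ^ i * q i) := by
    rw [hmq]
    refine (Finset.sum_le_card_nsmul _ _ (A ^ i * q i) fun j hj => ?_).trans_eq (by simp)
    exact (le_mul_of_one_le_left (hq0 j) (one_le_pow₀ hA1)).trans (hmax j hj)
  have hAik : A ^ i ≤ A ^ k := pow_le_pow_right₀ hA1 hik
  have hmle' : m ≤ (k + 1) * (A ^ k * q i) :=
    hmle.trans (by have := hq0 i; gcongr)
  have hhigh : ∀ j ∈ Finset.Ioc i k, q j ≤ q i / A := by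
    intro j hj
    rw [Finset.mem_Ioc] at hj
    rw [le_div_iff₀ hA0]
    have h1 := hmax j (Finset.mem_range.2 (by omega))
    have h2 : A ^ i * A ≤ A ^ j := by
      rw [← pow_succ]; exact pow_le_pow_right₀ hA1 (by omega)
    have h3 : A ^ i * (q j * A) ≤ A ^ i * q i := by
      calc A ^ i * (q j * A) = A ^ i * A * q j := by ring
        _ ≤ A ^ j * q j := by have := hq0 j; gcongr
        _ ≤ _ := h1
    exact le_of_mul_le_mul_left h3 (by positivity)
  have hsum : ∑ j ∈ Finset.Ioc i k, q j ≤ k * (q i / A) := by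
    refine (Finset.sum_le_card_nsmul _ _ _ hhigh).trans ?_
    rw [nsmul_eq_mul, Nat.card_Ioc]
    have : 0 ≤ q i / A := div_nonneg (hq0 i) hA0.le
    have h2 : ((k - i : ℕ) : ℝ) ≤ k := by exact_mod_cast Nat.sub_le k i
    gcongr
  have hrem : H * ρ ^ ((k : ℝ) + α) ≤ q i / A := by
    refine hsmall.trans ?_
    calc 1 / (A ^ (k + 1) * (k + 1)) * m ≤
          1 / (A ^ (k + 1) * (k + 1)) * ((k + 1) * (A ^ k * q i)) := by gcongr
      _ = q i / A := by rw [pow_succ]; field_simp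
  have hvar : ∀ z ∈ Metric.ball x ρ,
      ‖iteratedFDeriv ℝ i a z - iteratedFDeriv ℝ i a x‖ ≤ ‖iteratedFDeriv ℝ i a x‖ / (4 * K) := by
    intro z hz
    have h1 := pow_mul_norm_iteratedFDeriv_sub_le h.isOpen h.contDiffOn h.exponent_pos
      h.constant_nonneg h.holder hρ hx hik z hz
    have h2 : ρ ^ i * ‖iteratedFDeriv ℝ i a z - iteratedFDeriv ℝ i a x‖ ≤
        ρ ^ i * (‖iteratedFDeriv ℝ i a x‖ / (4 * K)) := by
      refine h1.trans ((add_le_add hsum hrem).trans_eq ?_)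
      rw [hq, hA]
      field_simp
    exact le_of_mul_le_mul_left h2 (by positivity)
  obtain ⟨v, hv, hv2⟩ := exists_half_diagNorm_le (iteratedFDeriv ℝ i a x)
  have hxU : x ∈ U := hx (Metric.mem_ball_self hρ)
  have hnorm := h.norm_le i hik x hxU
  -- At x the directional value is at least ‖D^i a(x)‖ / (2K), half from the choice of v and K from
  -- comparing norms; the variation consumes half of that.
  refine ⟨i, hik, v, hv, SignType.sign (iteratedFDeriv ℝ i a x fun _ => v),
    ‖iteratedFDeriv ℝ i a x‖ / (4 * K), ?_, ?_, ?_⟩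
  · have hqi : 0 < q i := by
      by_contra hn
      have : q i = 0 := le_antisymm (not_lt.1 hn) (hq0 i)
      rw [this] at hmle; simp at hmle; linarith
    have hp : 0 < ‖iteratedFDeriv ℝ i a x‖ := by
      by_contra hn
      have : ‖iteratedFDeriv ℝ i a x‖ = 0 := le_antisymm (not_lt.1 hn) (norm_nonneg _)
      simp [hq, this] at hqi
    have hne : (iteratedFDeriv ℝ i a x fun _ => v) ≠ 0 := by
      intro h0
      rw [h0, abs_zero] at hv2
      nlinarith
    rcases hne.lt_or_gt with h0 | h0 <;> simp [h0]
  · rw [div_le_iff₀ (by positivity)]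
    refine hmle'.trans_eq ?_
    rw [pow_succ, hq, hA]
    field_simp
  · intro z hz
    have h1 : |(iteratedFDeriv ℝ i a z - iteratedFDeriv ℝ i a x) fun _ => v| ≤
        ‖iteratedFDeriv ℝ i a x‖ / (4 * K) :=
      (abs_apply_le_diagNorm _ hv).trans ((diagNorm_le_norm _).trans (hvar z hz))
    rw [sub_apply] at h1
    have h2 : ‖iteratedFDeriv ℝ i a x‖ / (2 * K) ≤ |iteratedFDeriv ℝ i a x fun _ => v| := by
      refine le_trans ?_ hv2
      rw [div_le_div_iff₀ (by positivity) two_pos]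
      nlinarith
    have h3 : ‖iteratedFDeriv ℝ i a x‖ / (2 * K) =
        ‖iteratedFDeriv ℝ i a x‖ / (4 * K) + ‖iteratedFDeriv ℝ i a x‖ / (4 * K) := by
      field_simp; ring
    have h4 : 0 ≤ ‖iteratedFDeriv ℝ i a x‖ / (4 * K) := by positivity
    rw [abs_le] at h1
    rcases lt_trichotomy (iteratedFDeriv ℝ i a x fun _ => v) 0 with h0 | h0 | h0
    · rw [abs_of_neg h0] at h2
      simp only [h0, sign_neg, SignType.coe_neg, SignType.coe_one]
      linarith
    · rw [h0, abs_zero] at h2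
      simp only [h0, sign_zero, SignType.coe_zero, zero_mul]
      linarith
    · rw [abs_of_pos h0] at h2
      simp only [h0, sign_pos, SignType.coe_one]
      linarith

theorem aemeasurable_restrict (h : HolderData k α H K U a) {B : Set (EuclideanSpace ℝ (Fin N))}
    (hB : MeasurableSet B) (hBU : B ⊆ U) : AEMeasurable a (volume.restrict B) :=
  (h.contDiffOn.continuousOn.mono hBU).aemeasurable hB

/-- Negative powers of `a` are integrable on balls on which the derivatives at the centre dominate
the Hölder remainder. -/
theorem exists_lintegral_rpow_neg_le (h : HolderData k α H K U a) :
    ∃ ε > 0, ∃ C > 0, ∀ (x : EuclideanSpace ℝ (Fin N)) (ρ : ℝ), 0 < ρ → Metric.ball x ρ ⊆ U →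
      0 < derivSize k a x ρ → H * ρ ^ ((k : ℝ) + α) ≤ ε * derivSize k a x ρ →
      ∫⁻ z in Metric.ball x ρ, ENNReal.ofReal (a z) ^ (-(1 / ((k : ℝ) + α))) ≤
        ENNReal.ofReal (C * derivSize k a x ρ ^ (-(1 / ((k : ℝ) + α)))) *
          volume (Metric.ball x ρ) := by
  set A : ℝ := 4 * K * (k + 1) with hA
  have hα := h.exponent_pos
  have hk0 : (0 : ℝ) ≤ k := Nat.cast_nonneg k
  have hA0 : 0 < A := by have := h.one_le; positivity
  set γ : ℝ := 1 / ((k : ℝ) + α) with hγ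
  -- Any β > 1/κ with β k ≤ 1 would do; α/2 provides such a value uniformly in k, including k = 0.
  set β : ℝ := 1 / ((k : ℝ) + α / 2) with hβ
  have hγ0 : 0 < γ := by positivity
  have hβ0 : 0 < β := by positivity
  have hγβ : γ < β := by
    rw [hγ, hβ]; exact one_div_lt_one_div_of_lt (by positivity) (by linarith)
  have hβγ : 0 < β - γ := sub_pos.2 hγβ
  refine ⟨1 / (A ^ (k + 1) * (k + 1)), by positivity,
    2 ^ (N + k + 1) * (β / (β - γ) * (1 / A ^ (k + 1)) ^ (-γ)), by positivity, ?_⟩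
  intro x ρ hρ hx hm hsmall
  obtain ⟨i, hik, v, hv, s, c, hs, hcm, hlow⟩ :=
    h.exists_directional_lower_bound hA hρ hx hm hsmall
  set m := derivSize k a x ρ with hmdef
  set m' := m / A ^ (k + 1) with hm'
  have hm'0 : 0 < m' := by positivity
  have hc : 0 < c := by
    have : 0 < c * ρ ^ i := hm'0.trans_le hcm
    exact pos_of_mul_pos_left this (by positivity)
  have hβi : β * i ≤ 1 := by
    rw [hβ, div_mul_eq_mul_div, one_mul, div_le_one (by positivity)]
    have : (i : ℝ) ≤ k := by exact_mod_cast hik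
    linarith
  have hvolt : volume (Metric.ball x ρ) ≠ ⊤ := measure_ball_lt_top.ne
  have hball := (Metric.isOpen_ball (x := x) (ε := ρ)).measurableSet
  have key := lintegral_rpow_neg_le_of_measure_le (μ := volume.restrict (Metric.ball x ρ))
    (g := a) (h.aemeasurable_restrict hball hx)
    ((ae_restrict_mem hball).mono fun z hz => h.nonneg z (hx hz))
    (M := ENNReal.ofReal (2 ^ (N + k + 1)) * volume (Metric.ball x ρ))
    (ENNReal.mul_ne_top ENNReal.ofReal_ne_top hvolt) (m := m') (β := β) (γ := γ) hm'0 hγ0 hγβ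
    ?_ ?_
  · refine key.trans_eq ?_
    rw [mul_right_comm, ← ENNReal.ofReal_mul (by positivity)]
    congr 2
    rw [hm', div_eq_mul_one_div m, Real.mul_rpow hm.le (by positivity)]
    ring
  · rw [Measure.restrict_apply_univ]
    refine le_mul_of_one_le_left bot_le ?_
    rw [ENNReal.one_le_ofReal]
    exact one_le_pow₀ (by norm_num)
  · intro l hl
    rw [Measure.restrict_apply' hball]
    have hsub : {z | a z ≤ l} ∩ Metric.ball x ρ ⊆ {z | z ∈ Metric.ball x ρ ∧ |a z| ≤ l} := by
      rintro z ⟨hz, hzb⟩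
      exact ⟨hzb, by rwa [abs_of_nonneg (h.nonneg z (hx hzb))]⟩
    refine (measure_mono hsub).trans ((volume_ball_sublevel_le h.isOpen h.contDiffOn hρ hx hik hv
      hs hc hβ0 hβi hl hlow).trans ?_)
    rw [mul_right_comm, ← ENNReal.ofReal_mul (by positivity)]
    gcongr
    · norm_num
    · refine hcm.trans ?_
      gcongr
      linarith

end HolderData

/-! ### The gauge σ and its length scale -/

/-- The function `σ = ∑ ‖D^i a‖^{κ/(κ-i)}`, `κ = k + α`. -/
noncomputable def derivGauge {N : ℕ} (k : ℕ) (α : ℝ) (a : EuclideanSpace ℝ (Fin N) → ℝ)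
    (x : EuclideanSpace ℝ (Fin N)) : ℝ :=
  ∑ i ∈ Finset.range (k + 1),
    diagNorm (iteratedFDeriv ℝ i a x) ^ (((k : ℝ) + α) / ((k : ℝ) + α - (i : ℝ)))

/-- The length scale `σ^{1/κ}`. -/
noncomputable def derivScale {N : ℕ} (k : ℕ) (α : ℝ) (a : EuclideanSpace ℝ (Fin N) → ℝ)
    (x : EuclideanSpace ℝ (Fin N)) : ℝ :=
  derivGauge k α a x ^ (1 / ((k : ℝ) + α))

section Gauge

variable {N k : ℕ} {α : ℝ} {a : EuclideanSpace ℝ (Fin N) → ℝ} {x : EuclideanSpace ℝ (Fin N)}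

theorem derivGauge_nonneg : 0 ≤ derivGauge k α a x :=
  Finset.sum_nonneg fun _ _ => Real.rpow_nonneg (diagNorm_nonneg _) _

theorem derivScale_nonneg : 0 ≤ derivScale k α a x :=
  Real.rpow_nonneg derivGauge_nonneg _

theorem exponent_le_sub {k : ℕ} {α : ℝ} {i : ℕ} (hi : i ≤ k) : α ≤ (k : ℝ) + α - i := by
  have : (i : ℝ) ≤ k := by exact_mod_cast hi
  linarith

theorem derivScale_rpow (hα : 0 < α) :
    derivScale k α a x ^ ((k : ℝ) + α) = derivGauge k α a x := by
  have hk0 : (0 : ℝ) ≤ k := Nat.cast_nonneg k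
  rw [derivScale, ← Real.rpow_mul derivGauge_nonneg, one_div_mul_cancel (by positivity),
    Real.rpow_one]

theorem derivScale_le (hα : 0 < α) {t C : ℝ} (ht : 0 ≤ t) (hC : 0 ≤ C)
    (h : derivGauge k α a x ≤ C * t ^ ((k : ℝ) + α)) :
    derivScale k α a x ≤ C ^ (1 / ((k : ℝ) + α)) * t := by
  have hk0 : (0 : ℝ) ≤ k := Nat.cast_nonneg k
  refine (Real.rpow_le_rpow derivGauge_nonneg h (by positivity)).trans_eq ?_
  rw [Real.mul_rpow hC (by positivity), ← Real.rpow_mul ht, mul_one_div_cancel (by positivity),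
    Real.rpow_one]

theorem diagNorm_rpow_le_derivGauge {i : ℕ} (hi : i ≤ k) :
    diagNorm (iteratedFDeriv ℝ i a x) ^ (((k : ℝ) + α) / ((k : ℝ) + α - (i : ℝ))) ≤
      derivGauge k α a x :=
  Finset.single_le_sum (f := fun i : ℕ => diagNorm (iteratedFDeriv ℝ i a x) ^
      (((k : ℝ) + α) / ((k : ℝ) + α - (i : ℝ))))
    (fun _ _ => Real.rpow_nonneg (diagNorm_nonneg _) _) (Finset.mem_range.2 (Nat.lt_succ_of_le hi))

theorem diagNorm_le_derivScale_rpow (hα : 0 < α) {i : ℕ} (hi : i ≤ k) :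
    diagNorm (iteratedFDeriv ℝ i a x) ≤ derivScale k α a x ^ ((k : ℝ) + α - i) := by
  have hk0 : (0 : ℝ) ≤ k := Nat.cast_nonneg k
  have hp := hα.trans_le (exponent_le_sub hi)
  have h := Real.rpow_le_rpow (Real.rpow_nonneg (diagNorm_nonneg _) _)
    (diagNorm_rpow_le_derivGauge (a := a) (x := x) (α := α) hi)
    (z := ((k : ℝ) + α - i) / ((k : ℝ) + α)) (by positivity)
  rw [← Real.rpow_mul (diagNorm_nonneg _), div_mul_div_cancel₀ hp.ne', div_self (by positivity),
    Real.rpow_one] at h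
  refine h.trans_eq ?_
  rw [derivScale, ← Real.rpow_mul derivGauge_nonneg]
  congr 1
  ring

/-- Pigeonhole: some summand is at least σ/(k+1). Taking the power (κ-i)/κ ≤ 1 turns this into a
bound on the norm, losing at most the factor k + 1. -/
theorem exists_derivScale_rpow_le_diagNorm (hα : 0 < α) : ∃ i ≤ k,
    derivScale k α a x ^ ((k : ℝ) + α - i) / (k + 1) ≤ diagNorm (iteratedFDeriv ℝ i a x) := by
  have hk0 : (0 : ℝ) ≤ k := Nat.cast_nonneg k
  obtain ⟨i, hi, hmax⟩ := Finset.exists_le_of_sum_le (s := Finset.range (k + 1))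
    (f := fun _ => derivGauge k α a x / (k + 1))
    (g := fun i : ℕ => diagNorm (iteratedFDeriv ℝ i a x) ^
      (((k : ℝ) + α) / ((k : ℝ) + α - (i : ℝ)))) ⟨0, by simp⟩ (by
      rw [Finset.sum_const, Finset.card_range, nsmul_eq_mul]
      push_cast
      rw [mul_div_cancel₀ _ (by positivity)]
      exact le_rfl)
  have hik : i ≤ k := Nat.lt_succ_iff.1 (Finset.mem_range.1 hi)
  refine ⟨i, hik, ?_⟩
  have hp := hα.trans_le (exponent_le_sub hik)
  have h := Real.rpow_le_rpow (div_nonneg derivGauge_nonneg (by positivity)) hmax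
    (z := ((k : ℝ) + α - i) / ((k : ℝ) + α)) (by positivity)
  rw [← Real.rpow_mul (diagNorm_nonneg _), div_mul_div_cancel₀ hp.ne', div_self (by positivity),
    Real.rpow_one, Real.div_rpow derivGauge_nonneg (by positivity)] at h
  refine le_trans ?_ h
  have e : derivScale k α a x ^ ((k : ℝ) + α - i) =
      derivGauge k α a x ^ (((k : ℝ) + α - i) / ((k : ℝ) + α)) := by
    rw [derivScale, ← Real.rpow_mul derivGauge_nonneg]
    congr 1
    ring
  rw [e]
  have h1 : ((k : ℝ) + 1) ^ (((k : ℝ) + α - i) / ((k : ℝ) + α)) ≤ k + 1 := by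
    conv_rhs => rw [← Real.rpow_one ((k : ℝ) + 1)]
    refine Real.rpow_le_rpow_of_exponent_le (by linarith) ?_
    rw [div_le_one (by positivity)]
    linarith [(Nat.cast_nonneg i : (0 : ℝ) ≤ i)]
  have := Real.rpow_nonneg (derivGauge_nonneg (k := k) (α := α) (a := a) (x := x))
    (((k : ℝ) + α - i) / ((k : ℝ) + α))
  gcongr

end Gauge

/-! ### Growth and decay of σ, and the scale below which derivatives dominate -/

namespace HolderData

variable {N k : ℕ} {α H K : ℝ} {U : Set (EuclideanSpace ℝ (Fin N))}
  {a : EuclideanSpace ℝ (Fin N) → ℝ}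

/-- Growth of `σ` on a ball contained in the domain. -/
theorem exists_derivGauge_le (h : HolderData k α H K U a) :
    ∃ C ≥ 1, ∀ (x : EuclideanSpace ℝ (Fin N)) (ρ t : ℝ), 0 < ρ → Metric.ball x ρ ⊆ U → ρ ≤ t →
      derivScale k α a x ≤ t → ∀ z ∈ Metric.ball x ρ,
        derivGauge k α a z ≤ C * t ^ ((k : ℝ) + α) := by
  have hα := h.exponent_pos
  have hk0 : (0 : ℝ) ≤ k := Nat.cast_nonneg k
  have hK := h.one_le
  have hH := h.constant_nonneg
  set C' : ℝ := K * (k + 1) + H with hC'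
  have hC'1 : 1 ≤ C' := by nlinarith
  refine ⟨(k + 1) * C' ^ (((k : ℝ) + α) / α), ?_, ?_⟩
  · have : 1 ≤ C' ^ (((k : ℝ) + α) / α) := Real.one_le_rpow hC'1 (by positivity)
    nlinarith
  intro x ρ t hρ hx hρt hst z hz
  have ht : 0 < t := hρ.trans_le hρt
  have hxU : x ∈ U := hx (Metric.mem_ball_self hρ)
  have hp : ∀ j ≤ k, ‖iteratedFDeriv ℝ j a x‖ ≤ K * t ^ ((k : ℝ) + α - j) := by
    intro j hj
    have := hα.trans_le (exponent_le_sub hj)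
    refine (h.norm_le j hj x hxU).trans ?_
    gcongr
    exact (diagNorm_le_derivScale_rpow hα hj).trans
      (Real.rpow_le_rpow derivScale_nonneg hst this.le)
  have hd : ∀ i ≤ k, diagNorm (iteratedFDeriv ℝ i a z) ≤ C' * t ^ ((k : ℝ) + α - i) := by
    intro i hi
    refine (diagNorm_le_norm _).trans ?_
    have hv := pow_mul_norm_iteratedFDeriv_sub_le h.isOpen h.contDiffOn hα hH h.holder hρ hx hi z hz
    have hterm : ∀ j ∈ Finset.Ioc i k, ‖iteratedFDeriv ℝ j a x‖ * ρ ^ j ≤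
        ρ ^ i * (K * t ^ ((k : ℝ) + α - i)) := by
      intro j hj
      rw [Finset.mem_Ioc] at hj
      obtain ⟨d, rfl⟩ := Nat.exists_eq_add_of_lt hj.1
      have e : t ^ ((k : ℝ) + α - i) = t ^ ((k : ℝ) + α - (i + d + 1 : ℕ)) * t ^ (d + 1) := by
        rw [← Real.rpow_natCast t (d + 1), ← Real.rpow_add ht]
        congr 1; push_cast; ring
      calc ‖iteratedFDeriv ℝ (i + d + 1) a x‖ * ρ ^ (i + d + 1)
          ≤ K * t ^ ((k : ℝ) + α - (i + d + 1 : ℕ)) * (ρ ^ i * t ^ (d + 1)) := by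
            rw [add_assoc i d 1, pow_add, ← add_assoc]
            gcongr
            exact hp _ hj.2
        _ = _ := by rw [e]; ring
    have hsum : ∑ j ∈ Finset.Ioc i k, ‖iteratedFDeriv ℝ j a x‖ * ρ ^ j ≤
        k * (ρ ^ i * (K * t ^ ((k : ℝ) + α - i))) := by
      refine (Finset.sum_le_card_nsmul _ _ _ hterm).trans ?_
      rw [nsmul_eq_mul, Nat.card_Ioc]
      have h2 : ((k - i : ℕ) : ℝ) ≤ k := by exact_mod_cast Nat.sub_le k i
      gcongr
    have hrem : H * ρ ^ ((k : ℝ) + α) ≤ ρ ^ i * (H * t ^ ((k : ℝ) + α - i)) := by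
      have e : ρ ^ ((k : ℝ) + α) = ρ ^ i * ρ ^ ((k : ℝ) + α - i) := by
        rw [← Real.rpow_natCast ρ i, ← Real.rpow_add hρ]
        congr 1; ring
      have := hα.trans_le (exponent_le_sub hi)
      rw [e, mul_left_comm]
      gcongr
    have h1 : ‖iteratedFDeriv ℝ i a z - iteratedFDeriv ℝ i a x‖ ≤
        k * (K * t ^ ((k : ℝ) + α - i)) + H * t ^ ((k : ℝ) + α - i) := by
      have h2 : ρ ^ i * ‖iteratedFDeriv ℝ i a z - iteratedFDeriv ℝ i a x‖ ≤
          ρ ^ i * (k * (K * t ^ ((k : ℝ) + α - i)) + H * t ^ ((k : ℝ) + α - i)) := by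
        refine (hv.trans (add_le_add hsum hrem)).trans_eq ?_
        ring
      exact le_of_mul_le_mul_left h2 (by positivity)
    have h2 : ‖iteratedFDeriv ℝ i a z‖ ≤ ‖iteratedFDeriv ℝ i a x‖ +
      ‖iteratedFDeriv ℝ i a z - iteratedFDeriv ℝ i a x‖ := norm_le_insert' _ _
    refine (h2.trans (add_le_add (hp i hi) h1)).trans_eq ?_
    rw [hC']; ring
  -- The exponents κ/(κ-i) are at most κ/α, so `C' ≥ 1` gives one constant for all orders.
  have hfin : ∀ i ∈ Finset.range (k + 1), diagNorm (iteratedFDeriv ℝ i a z) ^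
      (((k : ℝ) + α) / ((k : ℝ) + α - (i : ℝ))) ≤ C' ^ (((k : ℝ) + α) / α) * t ^ ((k : ℝ) + α) := by
    intro i hi
    have hik : i ≤ k := Nat.lt_succ_iff.1 (Finset.mem_range.1 hi)
    have hge := exponent_le_sub (k := k) (α := α) hik
    have hpos := hα.trans_le hge
    refine (Real.rpow_le_rpow (diagNorm_nonneg _) (hd i hik) (by positivity)).trans ?_
    rw [Real.mul_rpow (by positivity) (by positivity), ← Real.rpow_mul ht.le,
      mul_div_cancel₀ _ hpos.ne']
    gcongr
  refine (Finset.sum_le_card_nsmul _ _ _ hfin).trans_eq ?_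
  rw [Finset.card_range, nsmul_eq_mul]
  push_cast
  ring

theorem continuousOn_derivGauge (h : HolderData k α H K U a) :
    ContinuousOn (derivGauge k α a) U := by
  have hα := h.exponent_pos
  have hk0 : (0 : ℝ) ≤ k := Nat.cast_nonneg k
  refine continuousOn_finsetSum _ fun i hi => ?_
  have hik : i ≤ k := Nat.lt_succ_iff.1 (Finset.mem_range.1 hi)
  have hpos := hα.trans_le (exponent_le_sub (k := k) (α := α) hik)
  refine ContinuousOn.rpow_const ?_ fun _ _ => Or.inr (by positivity)
  exact continuous_diagNorm.comp_continuousOn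
    (ContinuousOn.continuousOn_iteratedFDeriv h.contDiffOn h.isOpen (by exact_mod_cast hik))

/-- The decay property of `σ` on a set around whose points balls of a fixed radius are contained in
the domain. -/
theorem exists_derivGauge_decay (h : HolderData k α H K U a)
    {Ω : Set (EuclideanSpace ℝ (Fin N))} {δ S : ℝ} (hδ : 0 < δ)
    (hΩ : ∀ x ∈ Ω, Metric.ball x δ ⊆ U) (hS : ∀ x ∈ Ω, derivGauge k α a x ≤ S) :
    ∃ C ≥ 1, ∀ x ∈ Ω, ∀ y ∈ Ω,
      derivGauge k α a x ≤ C * (derivGauge k α a y + ‖x - y‖ ^ ((k : ℝ) + α)) := by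
  have hα := h.exponent_pos
  have hk0 : (0 : ℝ) ≤ k := Nat.cast_nonneg k
  have hκ : 0 < (k : ℝ) + α := by positivity
  obtain ⟨C, hC1, hC⟩ := h.exists_derivGauge_le
  have hC0 : 0 < C := zero_lt_one.trans_le hC1
  have h2κ : (1 : ℝ) ≤ 2 ^ ((k : ℝ) + α) := Real.one_le_rpow (by norm_num) hκ.le
  refine ⟨C * 2 ^ ((k : ℝ) + α) + |S| * (2 / δ) ^ ((k : ℝ) + α), ?_, ?_⟩
  · have : 0 ≤ |S| * (2 / δ) ^ ((k : ℝ) + α) := by positivity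
    nlinarith
  intro x hx y hy
  have hσy := derivGauge_nonneg (k := k) (α := α) (a := a) (x := y)
  have hr0 : 0 ≤ ‖x - y‖ ^ ((k : ℝ) + α) := by positivity
  have hfirst : derivGauge k α a x ≤
      C * 2 ^ ((k : ℝ) + α) * (derivGauge k α a y + ‖x - y‖ ^ ((k : ℝ) + α)) ∨
      derivGauge k α a x ≤
      |S| * (2 / δ) ^ ((k : ℝ) + α) * (derivGauge k α a y + ‖x - y‖ ^ ((k : ℝ) + α)) := by
    rcases eq_or_ne x y with rfl | hxy
    · left
      have : (1 : ℝ) ≤ C * 2 ^ ((k : ℝ) + α) := by nlinarith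
      nlinarith
    have hr : 0 < ‖x - y‖ := norm_pos_iff.2 (sub_ne_zero.2 hxy)
    -- Close points lie in a ball about y inside U, where the growth estimate applies at the larger
    -- of the radius and s(y). Distant points use only the bound S, since ‖x - y‖ ≥ δ/2.
    by_cases hlt : ‖x - y‖ < δ / 2
    · left
      set ρ := 2 * ‖x - y‖ with hρ
      have hρ0 : 0 < ρ := by positivity
      have h1 := hC y ρ (max ρ (derivScale k α a y)) hρ0
        ((Metric.ball_subset_ball (by linarith)).trans (hΩ y hy)) (le_max_left _ _)
        (le_max_right _ _) x (by rw [mem_ball_iff_norm]; linarith)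
      have h2 : max ρ (derivScale k α a y) ^ ((k : ℝ) + α) ≤
          2 ^ ((k : ℝ) + α) * (derivGauge k α a y + ‖x - y‖ ^ ((k : ℝ) + α)) := by
        rcases max_cases ρ (derivScale k α a y) with ⟨e, _⟩ | ⟨e, _⟩
        · rw [e, hρ, Real.mul_rpow two_pos.le hr.le]
          gcongr
          linarith
        · rw [e, derivScale_rpow hα]
          nlinarith
      calc derivGauge k α a x ≤ C * max ρ (derivScale k α a y) ^ ((k : ℝ) + α) := h1
        _ ≤ C * (2 ^ ((k : ℝ) + α) * (derivGauge k α a y + ‖x - y‖ ^ ((k : ℝ) + α))) := by gcongr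
        _ = _ := by ring
    · right
      push Not at hlt
      have h1 : 1 ≤ (2 / δ) ^ ((k : ℝ) + α) * ‖x - y‖ ^ ((k : ℝ) + α) := by
        rw [← Real.mul_rpow (by positivity) hr.le]
        refine Real.one_le_rpow ?_ hκ.le
        rw [div_mul_eq_mul_div, one_le_div hδ]
        linarith
      calc derivGauge k α a x ≤ |S| := (hS x hx).trans (le_abs_self S)
        _ ≤ |S| * ((2 / δ) ^ ((k : ℝ) + α) * ‖x - y‖ ^ ((k : ℝ) + α)) :=
            le_mul_of_one_le_right (abs_nonneg _) h1
        _ ≤ |S| * ((2 / δ) ^ ((k : ℝ) + α) *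
              (derivGauge k α a y + ‖x - y‖ ^ ((k : ℝ) + α))) := by
            gcongr
            linarith
        _ = _ := by ring
  have hp : 0 ≤ derivGauge k α a y + ‖x - y‖ ^ ((k : ℝ) + α) := by positivity
  rw [add_mul]
  rcases hfirst with h1 | h1
  · exact h1.trans (le_add_of_nonneg_right (by positivity))
  · exact h1.trans (le_add_of_nonneg_left (by positivity))

/-- At scales small compared with `σ^{1/κ}` the derivatives dominate the Hölder remainder. -/
theorem remainder_le_of_le_derivScale (h : HolderData k α H K U a) {c ε : ℝ} (hc0 : 0 < c)
    (hc1 : c ≤ 1) (hc : H * c ^ α ≤ ε / (k + 1)) (hε : 0 < ε) {x : EuclideanSpace ℝ (Fin N)} {ρ : ℝ}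
    (hρ : 0 < ρ) (hρs : ρ ≤ c * derivScale k α a x) :
    0 < derivSize k a x ρ ∧ H * ρ ^ ((k : ℝ) + α) ≤ ε * derivSize k a x ρ := by
  have hα := h.exponent_pos
  have hk0 : (0 : ℝ) ≤ k := Nat.cast_nonneg k
  have hH := h.constant_nonneg
  set s := derivScale k α a x with hs
  have hs0 : 0 < s := pos_of_mul_pos_right (hρ.trans_le hρs) hc0.le
  obtain ⟨i, hik, hi⟩ := exists_derivScale_rpow_le_diagNorm (k := k) (a := a) (x := x) hα
  have hge := exponent_le_sub (k := k) (α := α) hik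
  have hpos := hα.trans_le hge
  have hlow : s ^ ((k : ℝ) + α - i) / (k + 1) * ρ ^ i ≤ derivSize k a x ρ := by
    refine le_trans ?_ (norm_mul_pow_le_derivSize hρ.le hik)
    gcongr
    exact hi.trans (diagNorm_le_norm _)
  refine ⟨lt_of_lt_of_le (by positivity) hlow, ?_⟩
  have e : ρ ^ ((k : ℝ) + α) = ρ ^ i * ρ ^ ((k : ℝ) + α - i) := by
    rw [← Real.rpow_natCast ρ i, ← Real.rpow_add hρ]
    congr 1; ring
  -- Since c ≤ 1 and κ - i ≥ α, the gain is at least c^α whichever order i dominates.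
  have h1 : ρ ^ ((k : ℝ) + α - i) ≤ c ^ α * s ^ ((k : ℝ) + α - i) := by
    refine (Real.rpow_le_rpow hρ.le hρs hpos.le).trans ?_
    rw [Real.mul_rpow hc0.le hs0.le]
    gcongr ?_ * _
    exact Real.rpow_le_rpow_of_exponent_ge hc0 hc1 hge
  calc H * ρ ^ ((k : ℝ) + α) ≤ H * (ρ ^ i * (c ^ α * s ^ ((k : ℝ) + α - i))) := by
        rw [e]; gcongr
    _ = H * c ^ α * (s ^ ((k : ℝ) + α - i) * ρ ^ i) := by ring
    _ ≤ ε / (k + 1) * (s ^ ((k : ℝ) + α - i) * ρ ^ i) := by gcongr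
    _ = ε * (s ^ ((k : ℝ) + α - i) / (k + 1) * ρ ^ i) := by ring
    _ ≤ _ := by gcongr

/-- The order i found by pigeonhole contributes about s^(κ-i) (c s)^i, with c^i ≥ c^k. This lower
bound makes the average of ω^(-1/κ) bounded at the critical radius c s. -/
theorem le_derivSize_mul_derivScale (hα : 0 < α) {c : ℝ} (hc0 : 0 < c) (hc1 : c ≤ 1)
    {x : EuclideanSpace ℝ (Fin N)} (hs : 0 < derivScale k α a x) :
    c ^ k / (k + 1) * derivGauge k α a x ≤ derivSize k a x (c * derivScale k α a x) := by
  have hk0 : (0 : ℝ) ≤ k := Nat.cast_nonneg k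
  set s := derivScale k α a x
  obtain ⟨i, hik, hi⟩ := exists_derivScale_rpow_le_diagNorm (k := k) (a := a) (x := x) hα
  refine le_trans ?_ (norm_mul_pow_le_derivSize (by positivity) hik)
  calc c ^ k / (k + 1) * derivGauge k α a x
      = c ^ k * (s ^ ((k : ℝ) + α - i) / (k + 1) * s ^ i) := by
        have e : s ^ ((k : ℝ) + α) = s ^ ((k : ℝ) + α - i) * s ^ i := by
          rw [← Real.rpow_natCast s i, ← Real.rpow_add hs]
          congr 1; ring
        rw [← derivScale_rpow hα, e]
        ring
    _ ≤ c ^ i * (‖iteratedFDeriv ℝ i a x‖ * s ^ i) := by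
        gcongr ?_ * (?_ * _)
        · exact pow_le_pow_of_le_one hc0.le hc1 hik
        · exact hi.trans (diagNorm_le_norm _)
    _ = _ := by rw [mul_pow]; ring

end HolderData

theorem setLAverage_le_ofReal {X : Type*} [MeasurableSpace X] {μ : Measure X} {B : Set X}
    {f : X → ENNReal} {C : ℝ} (h : ∫⁻ z in B, f z ∂μ ≤ ENNReal.ofReal C * μ B) :
    ⨍⁻ z in B, f z ∂μ ≤ ENNReal.ofReal C := by
  rw [setLAverage_eq]
  exact ENNReal.div_le_of_le_mul h

/-! ### The weight ω -/

/-- The weight `a / σ`, set to `1` where `σ` vanishes. -/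
noncomputable def derivWeight {N : ℕ} (k : ℕ) (α : ℝ) (a : EuclideanSpace ℝ (Fin N) → ℝ)
    (z : EuclideanSpace ℝ (Fin N)) : ℝ :=
  -- Division by zero gives 0, so the indicator alone supplies the value 1; as a sum of measurable
  -- pieces the weight is visibly measurable.
  a z / derivGauge k α a z + ({0} : Set ℝ).indicator 1 (derivGauge k α a z)

section Weight

variable {N k : ℕ} {α : ℝ} {a : EuclideanSpace ℝ (Fin N) → ℝ} {z : EuclideanSpace ℝ (Fin N)}

theorem derivWeight_of_eq_zero (h : derivGauge k α a z = 0) : derivWeight k α a z = 1 := by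
  simp [derivWeight, h]

theorem derivWeight_of_ne_zero (h : derivGauge k α a z ≠ 0) :
    derivWeight k α a z = a z / derivGauge k α a z := by
  simp [derivWeight, h]

/-- The summand of order 0 has exponent κ/κ = 1 and equals |a|. -/
theorem le_derivGauge (hα : 0 < α) : a z ≤ derivGauge k α a z := by
  have hk0 : (0 : ℝ) ≤ k := Nat.cast_nonneg k
  have h := diagNorm_rpow_le_derivGauge (a := a) (x := z) (α := α) (Nat.zero_le k)
  rw [Nat.cast_zero, sub_zero, div_self (by positivity), Real.rpow_one] at h
  refine le_trans ?_ h
  have h2 := abs_apply_le_diagNorm (iteratedFDeriv ℝ 0 a z)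
    (v := (0 : EuclideanSpace ℝ (Fin N))) (by simp)
  rw [iteratedFDeriv_zero_apply] at h2
  exact (le_abs_self _).trans h2

theorem eq_derivGauge_mul_derivWeight (hα : 0 < α) (ha : 0 ≤ a z) :
    a z = derivGauge k α a z * derivWeight k α a z := by
  by_cases h : derivGauge k α a z = 0
  · rw [h, zero_mul]
    exact le_antisymm ((le_derivGauge hα).trans_eq h) ha
  · rw [derivWeight_of_ne_zero h, mul_div_cancel₀ _ h]

theorem derivWeight_nonneg (ha : 0 ≤ a z) : 0 ≤ derivWeight k α a z :=
  add_nonneg (div_nonneg ha derivGauge_nonneg) (Set.indicator_nonneg (fun _ _ => zero_le_one) _)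

theorem derivWeight_le_one (hα : 0 < α) : derivWeight k α a z ≤ 1 := by
  by_cases h : derivGauge k α a z = 0
  · exact (derivWeight_of_eq_zero h).le
  · rw [derivWeight_of_ne_zero h]
    exact div_le_one_of_le₀ (le_derivGauge hα) derivGauge_nonneg

theorem derivScale_eq_zero_iff (hα : 0 < α) :
    derivScale k α a z = 0 ↔ derivGauge k α a z = 0 := by
  have hk0 : (0 : ℝ) ≤ k := Nat.cast_nonneg k
  exact Real.rpow_eq_zero derivGauge_nonneg (by positivity)

/-- Where a > 0, ω^(-1/κ) = σ^(1/κ) a^(-1/κ). Where a = 0 the right side is ∞ because T > 0. -/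
theorem ofReal_derivWeight_rpow_neg_le (hα : 0 < α) (ha : 0 ≤ a z) {T : ℝ} (hT : 0 < T)
    (hσ : derivGauge k α a z ≤ T ^ ((k : ℝ) + α)) :
    ENNReal.ofReal (derivWeight k α a z) ^ (-(1 / ((k : ℝ) + α))) ≤
      ENNReal.ofReal T * ENNReal.ofReal (a z) ^ (-(1 / ((k : ℝ) + α))) := by
  have hk0 : (0 : ℝ) ≤ k := Nat.cast_nonneg k
  rcases ha.eq_or_lt with h0 | h0
  · rw [← h0, ENNReal.ofReal_zero, ENNReal.zero_rpow_of_neg (by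
      rw [neg_lt_zero]; positivity), ENNReal.mul_top (by simpa using hT)]
    exact le_top
  have hσ0 : 0 < derivGauge k α a z := h0.trans_le (le_derivGauge hα)
  rw [derivWeight_of_ne_zero hσ0.ne', ENNReal.ofReal_rpow_of_pos (by positivity),
    ENNReal.ofReal_rpow_of_pos h0, ← ENNReal.ofReal_mul hT.le]
  refine ENNReal.ofReal_le_ofReal ?_
  rw [Real.div_rpow ha hσ0.le, Real.rpow_neg hσ0.le, div_inv_eq_mul, mul_comm]
  gcongr
  refine (Real.rpow_le_rpow hσ0.le hσ (by positivity)).trans_eq ?_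
  rw [← Real.rpow_mul hT.le, mul_one_div_cancel (by positivity), Real.rpow_one]

theorem lintegral_ofReal_derivWeight_rpow_neg_le (hα : 0 < α)
    {B : Set (EuclideanSpace ℝ (Fin N))} (hB : MeasurableSet B) (ha : ∀ z ∈ B, 0 ≤ a z) {T : ℝ}
    (hT : 0 < T) (hσ : ∀ z ∈ B, derivGauge k α a z ≤ T ^ ((k : ℝ) + α)) :
    ∫⁻ z in B, ENNReal.ofReal (derivWeight k α a z) ^ (-(1 / ((k : ℝ) + α))) ≤
      ENNReal.ofReal T * ∫⁻ z in B, ENNReal.ofReal (a z) ^ (-(1 / ((k : ℝ) + α))) := by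
  rw [← lintegral_const_mul' _ _ ENNReal.ofReal_ne_top]
  exact setLIntegral_mono' hB fun z hz =>
    ofReal_derivWeight_rpow_neg_le hα (ha z hz) hT (hσ z hz)

end Weight

/-! ### Bounds on balls of radius at most a multiple of σ^(1/κ) -/

namespace HolderData

variable {N k : ℕ} {α H K : ℝ} {U : Set (EuclideanSpace ℝ (Fin N))}
  {a : EuclideanSpace ℝ (Fin N) → ℝ}

theorem aemeasurable_derivWeight (h : HolderData k α H K U a)
    {B : Set (EuclideanSpace ℝ (Fin N))} (hB : MeasurableSet B) (hBU : B ⊆ U) :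
    AEMeasurable (derivWeight k α a) (volume.restrict B) := by
  have hσ : AEMeasurable (derivGauge k α a) (volume.restrict B) :=
    (h.continuousOn_derivGauge.mono hBU).aemeasurable hB
  exact ((h.aemeasurable_restrict hB hBU).div hσ).add
    ((measurable_one.indicator (measurableSet_singleton 0)).comp_aemeasurable hσ)

/-- Integrability of the negative power of the weight on balls of radius comparable with `σ^{1/κ}`,
and the Muckenhoupt bound on smaller balls. -/
theorem exists_local_muckenhoupt_bounds (h : HolderData k α H K U a)
    {Ω : Set (EuclideanSpace ℝ (Fin N))} {δ S D : ℝ} (hδ : 0 < δ)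
    (hΩ : ∀ x ∈ Ω, Metric.ball x δ ⊆ U) (hS0 : 0 ≤ S)
    (hS : ∀ x ∈ Ω, derivScale k α a x ≤ S) (hD1 : 1 ≤ D)
    (hD : ∀ x ∈ Ω, ∀ y ∈ Ω,
      derivGauge k α a x ≤ D * (derivGauge k α a y + ‖x - y‖ ^ ((k : ℝ) + α))) :
    ∃ c > 0, ∃ C ≥ 0,
      (∀ x ∈ Ω, 0 < derivScale k α a x → Metric.ball x (c * derivScale k α a x) ⊆ U ∧
        ∫⁻ z in Metric.ball x (c * derivScale k α a x),
          ENNReal.ofReal (derivWeight k α a z) ^ (-(1 / ((k : ℝ) + α))) ≤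
            ENNReal.ofReal C * volume (Metric.ball x (c * derivScale k α a x))) ∧
      (∀ x ρ, 0 < ρ → ρ ≤ c * derivScale k α a x → Metric.ball x ρ ⊆ Ω →
        (⨍⁻ z in Metric.ball x ρ, ENNReal.ofReal (derivWeight k α a z) ∂volume) *
          (⨍⁻ z in Metric.ball x ρ,
            ENNReal.ofReal (derivWeight k α a z) ^ (-(1 / ((k : ℝ) + α))) ∂volume) ^ ((k : ℝ) + α) ≤
          ENNReal.ofReal C) := by
  have hα := h.exponent_pos
  have hk0 : (0 : ℝ) ≤ k := Nat.cast_nonneg k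
  have hH := h.constant_nonneg
  have hκ : 0 < (k : ℝ) + α := by positivity
  set κ : ℝ := (k : ℝ) + α with hκdef
  obtain ⟨ε, hε, C₁, hC₁, hint⟩ := h.exists_lintegral_rpow_neg_le
  obtain ⟨C₂, hC₂1, hgrow⟩ := h.exists_derivGauge_le
  have hC₂ : 0 < C₂ := zero_lt_one.trans_le hC₂1
  have hD0 : 0 < D := zero_lt_one.trans_le hD1
  -- The three smallness conditions on c, in order: balls of radius c s stay in U, the Hölder
  -- remainder is dominated, and σ is comparable with its central value.
  obtain ⟨c, hc0, hc1, hcS, hcH, hcD⟩ : ∃ c : ℝ, 0 < c ∧ c ≤ 1 ∧ c * S ≤ δ ∧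
      H * c ^ α ≤ ε / (k + 1) ∧ D * c ^ κ ≤ 1 / 2 := by
    refine ⟨min (min 1 (δ / (S + 1))) (min ((ε / (k + 1) / (H + 1)) ^ (1 / α))
      ((1 / (2 * D)) ^ (1 / κ))), ?_, ?_, ?_, ?_, ?_⟩
    · positivity
    · exact (min_le_left _ _).trans (min_le_left _ _)
    · refine (mul_le_mul_of_nonneg_right ((min_le_left _ _).trans (min_le_right _ _)) hS0).trans ?_
      rw [div_mul_eq_mul_div, div_le_iff₀ (by positivity)]
      nlinarith
    · have h1 : (min (min 1 (δ / (S + 1))) (min ((ε / (k + 1) / (H + 1)) ^ (1 / α))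
          ((1 / (2 * D)) ^ (1 / κ)))) ^ α ≤ ε / (k + 1) / (H + 1) := by
        refine (Real.rpow_le_rpow (by positivity)
          ((min_le_right _ _).trans (min_le_left _ _)) hα.le).trans_eq ?_
        rw [← Real.rpow_mul (by positivity), one_div_mul_cancel hα.ne', Real.rpow_one]
      refine (mul_le_mul_of_nonneg_left h1 hH).trans ?_
      rw [mul_div_assoc', div_le_iff₀ (by positivity), mul_comm]
      have : 0 ≤ ε / (k + 1) := by positivity
      nlinarith
    · have h1 : (min (min 1 (δ / (S + 1))) (min ((ε / (k + 1) / (H + 1)) ^ (1 / α))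
          ((1 / (2 * D)) ^ (1 / κ)))) ^ κ ≤ 1 / (2 * D) := by
        refine (Real.rpow_le_rpow (by positivity)
          ((min_le_right _ _).trans (min_le_right _ _)) hκ.le).trans_eq ?_
        rw [← Real.rpow_mul (by positivity), one_div_mul_cancel hκ.ne', Real.rpow_one]
      refine (mul_le_mul_of_nonneg_left h1 hD0.le).trans_eq ?_
      field_simp
  have hballU : ∀ x ∈ Ω, ∀ ρ ≤ c * derivScale k α a x, Metric.ball x ρ ⊆ U := fun x hx ρ hρ =>
    (Metric.ball_subset_ball (hρ.trans
      ((mul_le_mul_of_nonneg_left (hS x hx) hc0.le).trans hcS))).trans (hΩ x hx)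
  set G : ℝ := C₂ ^ (1 / κ) with hG
  have hG0 : 0 < G := by positivity
  have hGκ : ∀ s : ℝ, 0 ≤ s → (G * s) ^ κ = C₂ * s ^ κ := by
    intro s hs
    rw [Real.mul_rpow hG0.le hs, hG, ← Real.rpow_mul hC₂.le, one_div_mul_cancel hκ.ne',
      Real.rpow_one]
  -- Only the centre has to lie in Ω: the covering balls used later may leave Ω, though not U.
  have hWint : ∀ x ∈ Ω, ∀ ρ, 0 < ρ → ρ ≤ c * derivScale k α a x →
      ∫⁻ z in Metric.ball x ρ, ENNReal.ofReal (derivWeight k α a z) ^ (-(1 / κ)) ≤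
        ENNReal.ofReal (G * derivScale k α a x * (C₁ * derivSize k a x ρ ^ (-(1 / κ)))) *
          volume (Metric.ball x ρ) := by
    intro x hx ρ hρ hρs
    have hs0 : 0 < derivScale k α a x := pos_of_mul_pos_right (hρ.trans_le hρs) hc0.le
    have hU := hballU x hx ρ hρs
    obtain ⟨hm, hrem⟩ := h.remainder_le_of_le_derivScale hc0 hc1 hcH hε hρ hρs
    have hT : 0 < G * derivScale k α a x := by positivity
    have h1 := lintegral_ofReal_derivWeight_rpow_neg_le (k := k) (α := α) (a := a) hα
      (B := Metric.ball x ρ) Metric.isOpen_ball.measurableSet (fun z hz => h.nonneg z (hU hz)) hT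
      (fun z hz => by
        rw [hGκ _ hs0.le]
        exact hgrow x ρ _ hρ hU (hρs.trans (mul_le_of_le_one_left hs0.le hc1)) le_rfl z hz)
    refine h1.trans ?_
    rw [ENNReal.ofReal_mul hT.le, mul_assoc]
    gcongr
    exact hint x ρ hρ hU hm hrem
  set b : ℝ := c ^ k / (k + 1) with hb
  have hb0 : 0 < b := by positivity
  refine ⟨c, hc0, G * C₁ * b ^ (-(1 / κ)) + (1 + ε) * (2 * D) * (G * C₁) ^ κ, by positivity,
    ?_, ?_⟩
  · intro x hx hs0
    refine ⟨hballU x hx _ le_rfl, (hWint x hx _ (by positivity) le_rfl).trans ?_⟩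
    gcongr
    have hm := le_derivSize_mul_derivScale (a := a) hα hc0 hc1 hs0
    have h1 : derivSize k a x (c * derivScale k α a x) ^ (-(1 / κ)) ≤
        b ^ (-(1 / κ)) * (derivScale k α a x)⁻¹ := by
      rw [← derivScale_rpow hα] at hm
      refine (Real.rpow_le_rpow_of_nonpos (by positivity) hm
        (by rw [neg_nonpos]; positivity)).trans_eq ?_
      rw [Real.mul_rpow hb0.le (by positivity), ← Real.rpow_mul hs0.le, mul_neg,
        mul_one_div_cancel hκ.ne', Real.rpow_neg_one]
    calc G * derivScale k α a x * (C₁ * derivSize k a x (c * derivScale k α a x) ^ (-(1 / κ)))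
        ≤ G * derivScale k α a x * (C₁ * (b ^ (-(1 / κ)) * (derivScale k α a x)⁻¹)) := by gcongr
      _ = G * C₁ * b ^ (-(1 / κ)) := by field_simp
      _ ≤ _ := le_add_of_nonneg_right (by positivity)
  · intro x ρ hρ hρs hball
    have hx : x ∈ Ω := hball (Metric.mem_ball_self hρ)
    have hs0 : 0 < derivScale k α a x := pos_of_mul_pos_right (hρ.trans_le hρs) hc0.le
    have hU := hballU x hx ρ hρs
    obtain ⟨hm, hrem⟩ := h.remainder_le_of_le_derivScale hc0 hc1 hcH hε hρ hρs
    have hσ0 : 0 < derivGauge k α a x := by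
      rw [← derivScale_rpow hα]; positivity
    set m := derivSize k a x ρ with hmdef
    have hω : ∀ z ∈ Metric.ball x ρ,
        derivWeight k α a z ≤ (1 + ε) * (2 * D) * m / derivGauge k α a x := by
      intro z hz
      -- By the choice of c, the distance term in the decay inequality is at most σ(x)/2 and is
      -- absorbed on the left.
      have hzσ : derivGauge k α a x ≤ 2 * D * derivGauge k α a z := by
        have h1 := hD x hx z (hball hz)
        have h2 : ‖x - z‖ ^ κ ≤ c ^ κ * derivGauge k α a x := by
          rw [← derivScale_rpow hα, ← Real.mul_rpow hc0.le hs0.le]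
          refine Real.rpow_le_rpow (norm_nonneg _) ?_ hκ.le
          rw [norm_sub_rev]
          exact (mem_ball_iff_norm.1 hz).le.trans hρs
        have h3 : D * ‖x - z‖ ^ κ ≤ 1 / 2 * derivGauge k α a x :=
          (mul_le_mul_of_nonneg_left h2 hD0.le).trans (by
            rw [← mul_assoc]; gcongr)
        linarith
      have hz0 : 0 < derivGauge k α a z := by
        by_contra hn
        have : derivGauge k α a z = 0 := le_antisymm (not_lt.1 hn) derivGauge_nonneg
        rw [this, mul_zero] at hzσ
        linarith
      have haz : a z ≤ (1 + ε) * m := by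
        have h1 := pow_mul_norm_iteratedFDeriv_le h.isOpen h.contDiffOn hα hH h.holder hρ hU
          (Nat.zero_le k) hz
        rw [pow_zero, one_mul, norm_iteratedFDeriv_zero] at h1
        have h2 : a z ≤ m + H * ρ ^ κ := (Real.le_norm_self _).trans h1
        linarith
      rw [derivWeight_of_ne_zero hz0.ne', div_le_div_iff₀ hz0 hσ0]
      calc a z * derivGauge k α a x ≤ (1 + ε) * m * (2 * D * derivGauge k α a z) := by gcongr
        _ = _ := by ring
    have hB := (Metric.isOpen_ball (x := x) (ε := ρ)).measurableSet
    have havg1 : ⨍⁻ z in Metric.ball x ρ, ENNReal.ofReal (derivWeight k α a z) ∂volume ≤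
        ENNReal.ofReal ((1 + ε) * (2 * D) * m / derivGauge k α a x) := by
      refine setLAverage_le_ofReal ?_
      refine (setLIntegral_mono' hB fun z hz => ENNReal.ofReal_le_ofReal (hω z hz)).trans_eq ?_
      rw [setLIntegral_const]
    have havg2 := setLAverage_le_ofReal (hWint x hx ρ hρ hρs)
    refine (mul_le_mul' havg1 (ENNReal.rpow_le_rpow havg2 hκ.le)).trans ?_
    rw [ENNReal.ofReal_rpow_of_nonneg (by positivity) hκ.le, ← ENNReal.ofReal_mul (by positivity)]
    refine ENNReal.ofReal_le_ofReal (le_trans (le_of_eq ?_)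
      (le_add_of_nonneg_left (by positivity)))
    -- This factor is a constant times σ(x)/m, the reciprocal of the factor m/σ(x) bounding the
    -- average of ω.
    have e : (G * derivScale k α a x * (C₁ * m ^ (-(1 / κ)))) ^ κ =
        (G * C₁) ^ κ * derivGauge k α a x * m⁻¹ := by
      have e1 : G * derivScale k α a x * (C₁ * m ^ (-(1 / κ))) =
          G * C₁ * derivScale k α a x * m ^ (-(1 / κ)) := by ring
      rw [e1, Real.mul_rpow (by positivity) (by positivity),
        Real.mul_rpow (by positivity) hs0.le, derivScale_rpow hα, ← Real.rpow_mul hm.le, neg_mul,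
        one_div_mul_cancel hκ.ne', Real.rpow_neg_one]
    rw [e]
    field_simp

end HolderData

/-! ### Vitali covering -/

/-- Integral bound on a ball from bounds on balls of variable radius centred in it, by a Vitali
covering. -/
theorem setLIntegral_ball_le_of_local_bounds {N : ℕ} {W : EuclideanSpace ℝ (Fin N) → ENNReal}
    {r : EuclideanSpace ℝ (Fin N) → ℝ} {x₀ : EuclideanSpace ℝ (Fin N)} {ρ R C : ℝ}
    (hR : 0 ≤ R) (hC : 0 ≤ C) (hr0 : ∀ x, 0 ≤ r x)
    (hzero : ∀ x ∈ Metric.ball x₀ ρ, r x = 0 → W x ≤ 1)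
    (hpos : ∀ x ∈ Metric.ball x₀ ρ, 0 < r x →
      ∫⁻ z in Metric.ball x (r x), W z ≤ ENNReal.ofReal C * volume (Metric.ball x (r x)))
    (hrR : ∀ x ∈ Metric.ball x₀ ρ, r x ≤ R * ρ) :
    ∫⁻ z in Metric.ball x₀ ρ, W z ≤
      ENNReal.ofReal (1 + C * 8 ^ N * (1 + R) ^ N) * volume (Metric.ball x₀ ρ) := by
  set B := Metric.ball x₀ ρ with hB
  -- Disjoint balls of radius r/8 are selected. Enlarging them four times gives radius r/2, so the
  -- balls of radius r, on which the integral is controlled, cover all points with r > 0; the volume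
  -- ratio is 8^N.
  obtain ⟨u, hut, hdisj, hcov⟩ := Vitali.exists_disjoint_subfamily_covering_enlargement_closedBall
    {x | x ∈ B ∧ 0 < r x} id (fun x => r x / 8) (R * ρ / 8)
    (fun x hx => by have := hrR x hx.1; linarith) 4 (by norm_num)
  have hucount : u.Countable := by
    refine hdisj.countable_of_nonempty_interior fun x hx => ⟨x, ?_⟩
    refine Metric.ball_subset_interior_closedBall (Metric.mem_ball_self ?_)
    have := (hut hx).2
    positivity
  have : Countable u := hucount.to_subtype
  have hsub : B ⊆ (B ∩ {x | r x = 0}) ∪ ⋃ b : u, Metric.ball (b : EuclideanSpace ℝ (Fin N)) (r b) := by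
    intro x hx
    rcases (hr0 x).eq_or_lt with h | h
    · exact Or.inl ⟨hx, h.symm⟩
    · right
      obtain ⟨b, hbu, hb⟩ := hcov x ⟨hx, h⟩
      refine Set.mem_iUnion.2 ⟨⟨b, hbu⟩, ?_⟩
      have h1 := hb (Metric.mem_closedBall_self (by positivity))
      have h2 := (hut hbu).2
      refine Metric.closedBall_subset_ball ?_ h1
      linarith
  have h1 : ∫⁻ z in B ∩ {x | r x = 0}, W z ≤ volume B := by
    refine (setLIntegral_mono measurable_const fun x hx => hzero x hx.1 hx.2).trans ?_
    rw [setLIntegral_const, one_mul]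
    exact measure_mono Set.inter_subset_left
  have h2 : ∫⁻ z in ⋃ b : u, Metric.ball (b : EuclideanSpace ℝ (Fin N)) (r b), W z ≤
      ENNReal.ofReal (C * 8 ^ N * (1 + R) ^ N) * volume B := by
    calc ∫⁻ z in ⋃ b : u, Metric.ball (b : EuclideanSpace ℝ (Fin N)) (r b), W z
        ≤ ∑' b : u, ∫⁻ z in Metric.ball (b : EuclideanSpace ℝ (Fin N)) (r b), W z :=
          lintegral_iUnion_le _ _
      _ ≤ ∑' b : u, ENNReal.ofReal (C * 8 ^ N) *
            volume (Metric.closedBall (b : EuclideanSpace ℝ (Fin N)) (r b / 8)) := by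
          refine ENNReal.tsum_le_tsum fun b => ?_
          have hb := hut b.2
          refine (hpos b hb.1 hb.2).trans ?_
          have e : volume (Metric.ball (b : EuclideanSpace ℝ (Fin N)) (r b)) =
              ENNReal.ofReal (8 ^ N) *
                volume (Metric.ball (b : EuclideanSpace ℝ (Fin N)) (r b / 8)) := by
            have h8 : r b = 8 * (r b / 8) := by ring
            conv_lhs => rw [h8]
            rw [Measure.addHaar_ball_mul_of_pos volume _ (by norm_num : (0 : ℝ) < 8),
              finrank_euclideanSpace_fin, Measure.addHaar_ball_center volume (b : EuclideanSpace ℝ (Fin N))]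
          rw [e, ← mul_assoc, ← ENNReal.ofReal_mul hC]
          gcongr
          exact Metric.ball_subset_closedBall
      _ = ENNReal.ofReal (C * 8 ^ N) * volume (⋃ b ∈ u,
            Metric.closedBall b (r b / 8)) := by
          rw [ENNReal.tsum_mul_left]
          exact congrArg _ (measure_biUnion hucount hdisj
            fun b _ => Metric.isClosed_closedBall.measurableSet).symm
      _ ≤ ENNReal.ofReal (C * 8 ^ N) * volume (Metric.ball x₀ ((1 + R) * ρ)) := by
          gcongr
          refine Set.iUnion₂_subset fun b hb => ?_
          have hb1 := (hut hb).1
          have hb2 := hrR b hb1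
          have hb3 := (hut hb).2
          refine Metric.closedBall_subset_ball' ?_
          have := Metric.mem_ball.1 hb1
          linarith
      _ = _ := by
          rw [Measure.addHaar_ball_mul_of_pos volume _ (by positivity : (0 : ℝ) < 1 + R),
            finrank_euclideanSpace_fin, ← mul_assoc, ← ENNReal.ofReal_mul (by positivity), hB,
            Measure.addHaar_ball_center volume x₀]
  refine (lintegral_mono_set hsub).trans ((lintegral_union_le _ _ _).trans
    ((add_le_add h1 h2).trans_eq ?_))
  rw [ENNReal.ofReal_add zero_le_one (by positivity), ENNReal.ofReal_one, add_mul, one_mul]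

/-! ### From the diagonal norm to the operator norm -/

/-- A nonnegative function of Hölder class, with constants in operator norm. -/
theorem HolderClass.exists_holderData {N k : ℕ} {α : ℝ} {U : Set (EuclideanSpace ℝ (Fin N))}
    {a : EuclideanSpace ℝ (Fin N) → ℝ} (hα : 0 < α) (hU : IsOpen U) (ha0 : ∀ x ∈ U, 0 ≤ a x)
    (ha : HolderClass k α U a) : ∃ H K : ℝ, HolderData k α H K U a := by
  obtain ⟨hc, C, hC⟩ := ha
  have hsymm : ∀ i ≤ k, ∀ x ∈ U, ∀ (v : Fin i → EuclideanSpace ℝ (Fin N)) (π : Equiv.Perm (Fin i)),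
      iteratedFDeriv ℝ i a x (v ∘ π) = iteratedFDeriv ℝ i a x v := fun i hi x hx v π =>
    iteratedFDeriv_comp_perm_of_contDiffOn hU (hc.of_le (by exact_mod_cast hi)) hx v π
  -- The polarization constant of order k dominates those of all lower orders.
  refine ⟨2 ^ k * (k + 1) ^ k * |C|, 2 ^ k * (k + 1) ^ k, hU, hc, ha0, hα, by positivity, ?_, ?_, ?_⟩
  · intro x hx y hy
    have h := norm_le_diagNorm (iteratedFDeriv ℝ k a x - iteratedFDeriv ℝ k a y) fun v π => by
      rw [sub_apply, sub_apply, hsymm k le_rfl x hx, hsymm k le_rfl y hy]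
    refine h.trans ?_
    rw [mul_assoc _ |C|]
    gcongr
    refine (hC x hx y hy).trans ?_
    gcongr
    exact le_abs_self C
  · have h1 : (1 : ℝ) ≤ 2 ^ k := one_le_pow₀ (by norm_num)
    have h2 : (1 : ℝ) ≤ (k + 1 : ℝ) ^ k :=
      one_le_pow₀ (by linarith [(Nat.cast_nonneg k : (0 : ℝ) ≤ k)])
    nlinarith
  · intro i hi x hx
    refine (norm_le_diagNorm _ (hsymm i hi x hx)).trans ?_
    have hik : (i : ℝ) ≤ k := by exact_mod_cast hi
    have hi0 : (0 : ℝ) ≤ i := Nat.cast_nonneg i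
    refine mul_le_mul_of_nonneg_right ?_ (diagNorm_nonneg _)
    have h1 : (2 : ℝ) ^ i ≤ 2 ^ k := pow_le_pow_right₀ (by norm_num) hi
    have h2 : ((i : ℝ) + 1) ^ i ≤ (k + 1) ^ k :=
      (pow_le_pow_left₀ (by positivity) (by linarith) i).trans
        (pow_le_pow_right₀ (by linarith) hi)
    gcongr

/-! ### Assembly on a compactly contained set -/

namespace HolderData

variable {N k : ℕ} {α H K : ℝ} {U : Set (EuclideanSpace ℝ (Fin N))}
  {a : EuclideanSpace ℝ (Fin N) → ℝ}

/-- Decay of `σ` and the Muckenhoupt property of the weight `a / σ` on a compactly contained open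
set. -/
theorem decay_and_muckenhoupt (h : HolderData k α H K U a)
    {Ω : Set (EuclideanSpace ℝ (Fin N))} (hΩo : IsOpen Ω) (hΩU : CompactlyContained Ω U) :
    DecayClass ((k : ℝ) + α) Ω (derivGauge k α a) ∧
      MuckenhouptClass ((k : ℝ) + α + 1) Ω (derivWeight k α a) := by
  have hα := h.exponent_pos
  have hk0 : (0 : ℝ) ≤ k := Nat.cast_nonneg k
  have hκ : 0 < (k : ℝ) + α := by positivity
  have hsub : Ω ⊆ U := subset_closure.trans hΩU.2
  obtain ⟨δ, hδ, hδU⟩ := hΩU.1.exists_thickening_subset_open h.isOpen hΩU.2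
  have hball : ∀ x ∈ Ω, Metric.ball x δ ⊆ U := fun x hx =>
    (Metric.ball_subset_thickening (subset_closure hx) δ).trans hδU
  obtain ⟨S, hS⟩ := hΩU.1.exists_bound_of_continuousOn (h.continuousOn_derivGauge.mono hΩU.2)
  have hS1 : ∀ x ∈ Ω, derivGauge k α a x ≤ |S| := fun x hx =>
    (Real.le_norm_self _).trans ((hS x (subset_closure hx)).trans (le_abs_self S))
  have hS2 : ∀ x ∈ Ω, derivScale k α a x ≤ |S| ^ (1 / ((k : ℝ) + α)) := fun x hx =>
    Real.rpow_le_rpow derivGauge_nonneg (hS1 x hx) (by positivity)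
  obtain ⟨D, hD1, hD⟩ := h.exists_derivGauge_decay hδ hball hS1
  obtain ⟨c, hc, C, hC, hloc, hsmall⟩ :=
    h.exists_local_muckenhoupt_bounds hδ hball (by positivity) hS2 hD1 hD
  refine ⟨⟨fun _ _ => derivGauge_nonneg, D, hD⟩, fun x hx => derivWeight_nonneg (h.nonneg x (hsub hx)),
    h.aemeasurable_derivWeight hΩo.measurableSet hsub, ?_, ?_⟩
  · rw [ae_restrict_iff' hΩo.measurableSet, ae_iff]
    -- A point where ω fails to be positive has σ ≠ 0, hence is the centre of a ball on which
    -- ω^(-1/κ) has finite integral; there ω can vanish only on a null set.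
    refine measure_null_of_locally_null _ fun x hx => ?_
    have hx : x ∈ Ω ∧ ¬ 0 < derivWeight k α a x := by simpa using hx
    have hσ : derivGauge k α a x ≠ 0 := fun h0 =>
      hx.2 (by rw [derivWeight_of_eq_zero h0]; exact zero_lt_one)
    have hs : 0 < derivScale k α a x :=
      derivScale_nonneg.lt_of_ne' fun h0 => hσ ((derivScale_eq_zero_iff hα).1 h0)
    obtain ⟨hU, hint⟩ := hloc x hx.1 hs
    set B := Metric.ball x (c * derivScale k α a x) with hB
    have hBm : MeasurableSet B := Metric.isOpen_ball.measurableSet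
    refine ⟨{z | ¬(z ∈ Ω → 0 < derivWeight k α a z)} ∩ B, Filter.inter_mem self_mem_nhdsWithin
      (mem_nhdsWithin_of_mem_nhds (Metric.ball_mem_nhds x (by positivity))), ?_⟩
    have hfin := ae_lt_top'
      ((h.aemeasurable_derivWeight hBm hU).ennreal_ofReal.pow_const _)
      (hint.trans_lt (ENNReal.mul_lt_top ENNReal.ofReal_lt_top measure_ball_lt_top)).ne
    rw [← Measure.restrict_apply' hBm, ← ae_iff]
    filter_upwards [hfin] with z hz _
    by_contra hn
    rw [ENNReal.ofReal_of_nonpos (not_lt.1 hn), ENNReal.zero_rpow_of_neg (by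
      rw [neg_lt_zero]; positivity)] at hz
    exact lt_irrefl _ hz
  · rw [add_sub_cancel_right]
    set E : ℝ := D * ((1 / c) ^ ((k : ℝ) + α) + 1) with hE
    have hD0 : 0 < D := zero_lt_one.trans_le hD1
    have hE0 : 0 ≤ E := by positivity
    set R : ℝ := c * E ^ (1 / ((k : ℝ) + α)) with hR
    have hR0 : 0 ≤ R := by positivity
    set X : ℝ := 1 + C * 8 ^ N * (1 + R) ^ N with hX
    have hX0 : 0 ≤ X := by positivity
    refine lt_of_le_of_lt (iSup_le fun x => iSup_le fun ρ => iSup_le fun hρ => iSup_le fun hBΩ => ?_)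
      (ENNReal.ofReal_lt_top (r := max C (X ^ ((k : ℝ) + α))))
    by_cases hρs : ρ ≤ c * derivScale k α a x
    · exact (hsmall x ρ hρ hρs hBΩ).trans (ENNReal.ofReal_le_ofReal (le_max_left _ _))
    push Not at hρs
    have hxΩ : x ∈ Ω := hBΩ (Metric.mem_ball_self hρ)
    have hBm : MeasurableSet (Metric.ball x ρ) := Metric.isOpen_ball.measurableSet
    have h1 : ⨍⁻ z in Metric.ball x ρ, ENNReal.ofReal (derivWeight k α a z) ∂volume ≤
        ENNReal.ofReal 1 := by
      refine setLAverage_le_ofReal ?_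
      refine (setLIntegral_mono' hBm fun z _ =>
        ENNReal.ofReal_le_ofReal (derivWeight_le_one hα)).trans_eq ?_
      rw [setLIntegral_const]
    -- Since s(x) < ρ/c, decay bounds σ on the ball by E ρ^κ, so the covering radii are at most a
    -- fixed multiple of ρ.
    have hscale : ∀ y ∈ Metric.ball x ρ, c * derivScale k α a y ≤ R * ρ := by
      intro y hy
      have hg : derivGauge k α a y ≤ E * ρ ^ ((k : ℝ) + α) := by
        have hx1 : derivGauge k α a x ≤ (1 / c) ^ ((k : ℝ) + α) * ρ ^ ((k : ℝ) + α) := by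
          rw [← derivScale_rpow hα, ← Real.mul_rpow (by positivity) hρ.le]
          refine Real.rpow_le_rpow derivScale_nonneg ?_ hκ.le
          rw [one_div, le_inv_mul_iff₀ hc]
          exact hρs.le
        have hy1 : ‖y - x‖ ^ ((k : ℝ) + α) ≤ ρ ^ ((k : ℝ) + α) :=
          Real.rpow_le_rpow (norm_nonneg _) (mem_ball_iff_norm.1 hy).le hκ.le
        calc derivGauge k α a y ≤ D * (derivGauge k α a x + ‖y - x‖ ^ ((k : ℝ) + α)) :=
              hD y (hBΩ hy) x hxΩ
          _ ≤ D * ((1 / c) ^ ((k : ℝ) + α) * ρ ^ ((k : ℝ) + α) + ρ ^ ((k : ℝ) + α)) := by gcongr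
          _ = _ := by rw [hE]; ring
      rw [hR, mul_assoc]
      exact mul_le_mul_of_nonneg_left (derivScale_le hα hρ.le hE0 hg) hc.le
    have h2 := setLAverage_le_ofReal (setLIntegral_ball_le_of_local_bounds
      (W := fun z => ENNReal.ofReal (derivWeight k α a z) ^ (-(1 / ((k : ℝ) + α))))
      (r := fun z => c * derivScale k α a z) hR0 hC
      (fun y => mul_nonneg hc.le derivScale_nonneg)
      (fun y _ h0 => by
        have hs0 : derivScale k α a y = 0 := (mul_eq_zero.1 h0).resolve_left hc.ne'
        rw [derivWeight_of_eq_zero ((derivScale_eq_zero_iff hα).1 hs0), ENNReal.ofReal_one,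
          ENNReal.one_rpow])
      (fun y hy h0 => (hloc y (hBΩ hy) (pos_of_mul_pos_right h0 hc.le)).2) hscale)
    refine (mul_le_mul' h1 (ENNReal.rpow_le_rpow h2 hκ.le)).trans ?_
    rw [ENNReal.ofReal_one, one_mul, ENNReal.ofReal_rpow_of_nonneg hX0 hκ.le]
    exact ENNReal.ofReal_le_ofReal (le_max_right _ _)

end HolderData

theorem mainTheorem2 (N k : ℕ) (α : ℝ) (hα_pos : 0 < α) (hα_le : α ≤ 1)
    (Ω U : Set (EuclideanSpace ℝ (Fin N)))
    (hΩ : IsOpen Ω) (hU : IsOpen U) (hU_bdd : Bornology.IsBounded U)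
    (hΩU : CompactlyContained Ω U)
    (a : EuclideanSpace ℝ (Fin N) → ℝ) (ha_nonneg : ∀ x ∈ U, 0 ≤ a x)
    (ha : HolderClass k α U a) :
    ∃ σ ω : EuclideanSpace ℝ (Fin N) → ℝ,
      (∀ x ∈ Ω, σ x = ∑ i ∈ Finset.range (k + 1),
        diagNorm (iteratedFDeriv ℝ i a x) ^ (((k : ℝ) + α) / ((k : ℝ) + α - (i : ℝ)))) ∧
      DecayClass ((k : ℝ) + α) Ω σ ∧
      MuckenhouptClass ((k : ℝ) + α + 1) Ω ω ∧
      MemLp ω ⊤ (volume.restrict Ω) ∧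
      ∀ x ∈ Ω, a x = σ x * ω x := by
  obtain ⟨H, K, h⟩ := ha.exists_holderData hα_pos hU ha_nonneg
  have hsub : Ω ⊆ U := subset_closure.trans hΩU.2
  obtain ⟨hdecay, hmuck⟩ := h.decay_and_muckenhoupt hΩ hΩU
  refine ⟨derivGauge k α a, derivWeight k α a, fun _ _ => rfl, hdecay, hmuck, ?_,
    fun x hx => eq_derivGauge_mul_derivWeight hα_pos (ha_nonneg x (hsub hx))⟩
  refine memLp_top_of_bound hmuck.aemeasurable.aestronglyMeasurable 1 ?_
  filter_upwards [ae_restrict_mem hΩ.measurableSet] with x hx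
  rw [Real.norm_of_nonneg (hmuck.nonneg x hx)]
  exact derivWeight_le_one hα_pos
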